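/- Let $G=(V,E)$ be a finite connected simple graph and let $\varphi$ assign to each oriented edge $(u,v)$ of $G$ a complex number $\varphi(u,v)$ with $|\varphi(u,v)|=1$ such that $\varphi(v,u)=\varphi(u,v)^{-1}$. Let $r(G,\varphi)$ be the rank of the Hermitian $V\times V$ matrix whose $(u,v)$ entry is $\varphi(u,v)$ if $uv\in E$ and $0$ otherwise. For a graph $H$, let $m(H)$ be its matching number (the maximum number of edges in a matching) and $c(H)=|E(H)|-|V(H)|+\omega(H)$ its cyclomatic number, where $\omega(H)$ is the number of connected components. For a cycle $C=v_1v_2\cdots v_lv_1$ of $G$, put $\varphi(C)=\varphi(v_1,v_2)\varphi(v_2,v_3)\cdots\varphi(v_{l-1},v_l)\varphi(v_l,v_1)$. Let $O(G)$ be the set of vertices of $G$ that lie on some cycle, let $G-O(G)$ be the subgraph induced by the remaining vertices, and let $T_G$ be the simple graph obtained from $G$ by contracting each cycle to a vertex (that is, the quotient of $G$, without loops and multiple edges, by the equivalence relation generated by identifying any two vertices that lie on a common cycle). Then $r(G,\varphi)=2m(G)-2c(G)$ if and only if all of the following conditions hold: (i) the cycles (if any) of $G$ are pairwise vertex-disjoint;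 (ii) every cycle (if any) $C$ of $G$, of length $l$, satisfies: $l$ is even and $\varphi(C)=(-1)^{l/2}$; (iii) $m(T_G)=m(G-O(G))$. -/

import Mathlib

namespace UnitGain

/-- A complex unit gain graph on the vertex set `V`: a simple graph together with a map from its
oriented edges to the unit circle such that reversing an edge inverts its gain. -/
structure UnitGainGraph (V : Type*) where
  /-- the underlying graph -/
  graph : SimpleGraph V
  /-- the gain of an oriented edge -/
  gain : graph.Dart → Circle
  gain_symm : ∀ d : graph.Dart, gain d.symm = (gain d)⁻¹

open Classical in
/-- The Hermitian adjacency matrix of a complex unit gain graph. -/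
noncomputable def UnitGainGraph.adjMatrix {V : Type*} (Φ : UnitGainGraph V) : Matrix V V ℂ :=
  Matrix.of fun i j => if h : Φ.graph.Adj i j then (Φ.gain ⟨(i, j), h⟩ : ℂ) else 0

/-- The rank of a complex unit gain graph. -/
noncomputable def UnitGainGraph.rank {V : Type*} [Fintype V] (Φ : UnitGainGraph V) : ℕ :=
  Φ.adjMatrix.rank

/-- The gain of a walk: the product of the gains of its successive oriented edges. -/
noncomputable def UnitGainGraph.walkGain {V : Type*} (Φ : UnitGainGraph V) {u v : V}
    (p : Φ.graph.Walk u v) : Circle :=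
  (p.darts.map Φ.gain).prod

/-- The matching number of a finite graph: the largest number of edges of a matching. -/
noncomputable def matchingNumber {V : Type*} (G : SimpleGraph V) : ℕ :=
  sSup {k : ℕ | ∃ M : G.Subgraph, M.IsMatching ∧ M.edgeSet.ncard = k}

/-- The cyclomatic number of a finite graph: edges minus vertices plus connected components. -/
noncomputable def cyclomaticNumber {V : Type*} (G : SimpleGraph V) : ℤ :=
  (Nat.card G.edgeSet : ℤ) - (Nat.card V : ℤ) + (Nat.card G.ConnectedComponent : ℤ)

/-- The cycles of a graph, as subgraphs. -/
def cycles {V : Type*} (G : SimpleGraph V) : Set G.Subgraph :=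
  {C | ∃ (v : V) (p : G.Walk v v), p.IsCycle ∧ p.toSubgraph = C}

/-- Distinct cycles have no vertex in common. -/
def CyclesDisjoint {V : Type*} (G : SimpleGraph V) : Prop :=
  (cycles G).Pairwise fun C D => Disjoint C.verts D.verts

/-- The set of vertices that lie on some cycle. -/
def cycleVertices {V : Type*} (G : SimpleGraph V) : Set V :=
  {v | ∃ C ∈ cycles G, v ∈ C.verts}

/-- The equivalence relation generated by identifying any two vertices of a common cycle. -/
def cycleSetoid {V : Type*} (G : SimpleGraph V) : Setoid V :=
  Relation.EqvGen.setoid fun u v => ∃ C ∈ cycles G, u ∈ C.verts ∧ v ∈ C.verts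

/-- The graph obtained by contracting each cycle to a vertex: two distinct classes are adjacent when
some edge of `G` joins them. -/
def contractCycles {V : Type*} (G : SimpleGraph V) : SimpleGraph (Quotient (cycleSetoid G)) :=
  G.map (Quotient.mk (cycleSetoid G))

/-- Deletion of a set of vertices. -/
def deleteVertices {V : Type*} (G : SimpleGraph V) (S : Set V) : SimpleGraph ↥(Sᶜ) :=
  G.induce Sᶜ

end UnitGain

open UnitGain

/-! Write r, m, c for rank, matching number and cyclomatic number, and O for the set of cycle
vertices. Deleting vertices one at a time gives 2m ≤ r + 2c
(`two_mul_matchingNumber_le_gainRank_add`): removing the neighbour of a leaf lowers r by at least 2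
and does not raise c; removing a cycle vertex lowers c by at least 1 and does not raise r; either
lowers m by at most 1. Deletion is modelled by `isolate`: isolated vertices change none of r, m, c,
so induction runs over the graphs on one fixed vertex type.

If the bound is attained, every such step is tight. A cycle vertex then costs exactly one unit of c,
which forbids two cycles from meeting (`cyclesSeparated_of_cyclomaticNumber`). It costs no rank, so
some kernel vector is nonzero there; once leaves and other cycles are stripped away, following that
vector around the cycle yields the gain, and tightness of m yields even length
(`IsExtremal.good_of_unique_cycle`). Condition (iii) is reached in Kőnig form: an `IsCertificate`
provides a set K and a matching M, both off the cycles, with |K| ≤ |M| and K covering every bridge,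
whence m(T_G) ≤ |K| ≤ |M| ≤ m(G - O) ≤ m(T_G). It is built by induction; the hard case, a bridge but
no leaf, compares the certificates of two deletions on a pendant cycle
(`IsExtremal.exists_isCertificate_of_bridge`).

Conversely, T_G is a forest, so Kőnig gives a cover of size m(T_G) = m(G - O). Counting forces it to
avoid the contracted cycles, so it lifts to a set K off the cycles that covers all bridges. Deleting
K costs at most 2|K| in rank and leaves disjoint singular even cycles, of rank at most |O| - 2c. A
maximum matching of G - O together with perfect matchings of the cycles gives 2m ≥ 2|K| + |O|, hence
r ≤ 2m - 2c (`isExtremal_of_matchingNumber_eq`). -/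

namespace UnitGain

open SimpleGraph Classical

/-! ### Vertex deletion, cycles, bridges and leaves -/

section GraphBasics

variable {V : Type*}

/-- Deletion of all edges that meet a set of vertices. -/
def isolate (G : SimpleGraph V) (S : Set V) : SimpleGraph V where
  Adj a b := G.Adj a b ∧ a ∉ S ∧ b ∉ S
  symm := ⟨fun _ _ h => ⟨h.1.symm, h.2.2, h.2.1⟩⟩
  loopless := ⟨fun _ h => h.1.ne rfl⟩

lemma isolate_adj {G : SimpleGraph V} {S : Set V} {a b : V} :
    (isolate G S).Adj a b ↔ G.Adj a b ∧ a ∉ S ∧ b ∉ S := Iff.rfl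

lemma isolate_le (G : SimpleGraph V) (S : Set V) : isolate G S ≤ G := fun _ _ h => h.1

lemma isolate_lt {G : SimpleGraph V} {S : Set V} {a b : V} (h : G.Adj a b) (ha : a ∈ S) :
    isolate G S < G :=
  lt_of_le_not_ge (isolate_le G S) fun he => (he h).2.1 ha

lemma mem_cycleVertices {G : SimpleGraph V} {v : V} :
    v ∈ cycleVertices G ↔ ∃ (u : V) (p : G.Walk u u), p.IsCycle ∧ v ∈ p.support := by
  constructor
  · rintro ⟨C, ⟨u, p, hp, rfl⟩, hv⟩
    exact ⟨u, p, hp, by simpa using hv⟩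
  · rintro ⟨u, p, hp, hv⟩
    exact ⟨p.toSubgraph, ⟨u, p, hp, rfl⟩, by simpa using hv⟩

lemma exists_isCycle_of_mem_cycleVertices {G : SimpleGraph V} {v : V} (h : v ∈ cycleVertices G) :
    ∃ p : G.Walk v v, p.IsCycle := by
  obtain ⟨u, p, hp, hv⟩ := mem_cycleVertices.1 h
  exact ⟨p.rotate _ hv, hp.rotate hv⟩

/-- An edge that lies on a cycle. -/
def IsCycleEdge (G : SimpleGraph V) (e : Sym2 V) : Prop :=
  ∃ (u : V) (p : G.Walk u u), p.IsCycle ∧ e ∈ p.edges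

lemma IsCycleEdge.mem_edgeSet {G : SimpleGraph V} {e : Sym2 V} (h : IsCycleEdge G e) :
    e ∈ G.edgeSet := by
  obtain ⟨u, p, -, he⟩ := h
  exact p.edges_subset_edgeSet he

lemma isCycleEdge_iff {G : SimpleGraph V} {e : Sym2 V} (he : e ∈ G.edgeSet) :
    IsCycleEdge G e ↔ ¬ G.IsBridge e := by
  rw [isBridge_iff_forall_cycle_notMem he, IsCycleEdge]
  push Not
  rfl

lemma IsCycleEdge.mem_cycleVertices {G : SimpleGraph V} {e : Sym2 V} (h : IsCycleEdge G e) {v : V}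
    (hv : v ∈ e) : v ∈ cycleVertices G := by
  obtain ⟨u, p, hp, he⟩ := h
  exact UnitGain.mem_cycleVertices.2 ⟨u, p, hp, p.mem_support_of_mem_edges he hv⟩

lemma IsCycleEdge.mono {G H : SimpleGraph V} (hGH : G ≤ H) {e : Sym2 V} (h : IsCycleEdge G e) :
    IsCycleEdge H e := by
  obtain ⟨u, p, hp, he⟩ := h
  have hq : ∀ e ∈ p.edges, e ∈ H.edgeSet :=
    fun e he => edgeSet_mono hGH (p.edges_subset_edgeSet he)
  exact ⟨u, p.transfer H hq, hp.transfer hq, by simpa using he⟩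

lemma exists_edge_of_mem_support {G : SimpleGraph V} {u v : V} {p : G.Walk u u} (hp : p.IsCycle)
    (hv : v ∈ p.support) : ∃ w, s(v, w) ∈ p.edges := by
  have h2 := hp.ncard_neighborSet_toSubgraph_eq_two hv
  obtain ⟨w, hw⟩ : (p.toSubgraph.neighborSet v).Nonempty := by
    rw [Set.nonempty_iff_ne_empty]
    intro h
    simp [h] at h2
  refine ⟨w, ?_⟩
  rw [Subgraph.mem_neighborSet, ← Subgraph.mem_edgeSet, Walk.edgeSet_toSubgraph] at hw
  exact hw

lemma exists_isCycleEdge_of_mem_cycleVertices {G : SimpleGraph V} {v : V}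
    (h : v ∈ cycleVertices G) : ∃ w, IsCycleEdge G s(v, w) := by
  obtain ⟨u, p, hp, hv⟩ := mem_cycleVertices.1 h
  obtain ⟨w, hw⟩ := exists_edge_of_mem_support hp hv
  exact ⟨w, u, p, hp, hw⟩

lemma mem_cycleVertices_of_isCycle {G : SimpleGraph V} {u v : V} {p : G.Walk u u} (hp : p.IsCycle)
    (hv : v ∈ p.support) : v ∈ cycleVertices G := mem_cycleVertices.2 ⟨u, p, hp, hv⟩

lemma edges_subset_isolate {G : SimpleGraph V} {S : Set V} {u v : V} {p : G.Walk u v}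
    (h : ∀ w ∈ p.support, w ∉ S) : ∀ e ∈ p.edges, e ∈ (isolate G S).edgeSet := by
  intro e
  induction e with | _ a b
  intro he
  exact ⟨p.adj_of_mem_edges he, h a (p.fst_mem_support_of_mem_edges he),
    h b (p.snd_mem_support_of_mem_edges he)⟩

lemma notMem_of_isCycle_isolate {G : SimpleGraph V} {S : Set V} {u v : V}
    {p : (isolate G S).Walk u u} (hp : p.IsCycle) (hv : v ∈ p.support) : v ∉ S := by
  obtain ⟨w, hw⟩ := exists_edge_of_mem_support hp hv
  exact (p.adj_of_mem_edges hw).2.1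

lemma edges_subset_of_le {G H : SimpleGraph V} (h : G ≤ H) {u v : V} (p : G.Walk u v) :
    ∀ e ∈ p.edges, e ∈ H.edgeSet :=
  fun _ he => edgeSet_mono h (p.edges_subset_edgeSet he)

/-- Two cycles with a common vertex have the same edges. -/
def CyclesSeparated (G : SimpleGraph V) : Prop :=
  ∀ (u w x : V) (p : G.Walk u u) (q : G.Walk w w), p.IsCycle → q.IsCycle → x ∈ p.support →
    x ∈ q.support → ∀ e ∈ p.edges, e ∈ q.edges

lemma CyclesSeparated.mem_support {G : SimpleGraph V} (h : CyclesSeparated G) {u w x y : V}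
    {p : G.Walk u u} {q : G.Walk w w} (hp : p.IsCycle) (hq : q.IsCycle) (hxp : x ∈ p.support)
    (hxq : x ∈ q.support) (hy : y ∈ p.support) : y ∈ q.support := by
  obtain ⟨z, hz⟩ := exists_edge_of_mem_support hp hy
  exact q.fst_mem_support_of_mem_edges (h _ _ x p q hp hq hxp hxq _ hz)

lemma CyclesSeparated.anti {G H : SimpleGraph V} (hGH : G ≤ H) (h : CyclesSeparated H) :
    CyclesSeparated G := by
  intro u w x p q hp hq hxp hxq e he
  have := h u w x (p.transfer H (edges_subset_of_le hGH p)) (q.transfer H (edges_subset_of_le hGH q))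
    (hp.transfer _) (hq.transfer _) (by simpa using hxp) (by simpa using hxq) e (by simpa using he)
  simpa using this

lemma cyclesSeparated_iff {G : SimpleGraph V} : CyclesSeparated G ↔ CyclesDisjoint G := by
  constructor
  · rintro h _ ⟨u, p, hp, rfl⟩ _ ⟨w, q, hq, rfl⟩ hne
    rw [Set.disjoint_left]
    intro x hx hx'
    rw [Walk.mem_verts_toSubgraph] at hx hx'
    apply hne
    ext a b
    · simp only [Walk.mem_verts_toSubgraph]
      exact ⟨h.mem_support hp hq hx hx', h.mem_support hq hp hx' hx⟩
    · rw [← Subgraph.mem_edgeSet, ← Subgraph.mem_edgeSet, Walk.edgeSet_toSubgraph,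
        Walk.edgeSet_toSubgraph]
      exact ⟨h _ _ x _ _ hp hq hx hx' _, h _ _ x _ _ hq hp hx' hx _⟩
  · intro h u w x p q hp hq hxp hxq e he
    by_contra hne
    have := h ⟨u, p, hp, rfl⟩ ⟨w, q, hq, rfl⟩ (fun heq => hne (by
      have : e ∈ p.toSubgraph.edgeSet := by rw [Walk.edgeSet_toSubgraph]; exact he
      rw [heq, Walk.edgeSet_toSubgraph] at this
      exact this))
    exact Set.disjoint_left.1 this (by simpa using hxp : x ∈ _) (by simpa using hxq)

lemma cycleVertices_mono {G H : SimpleGraph V} (h : G ≤ H) : cycleVertices G ⊆ cycleVertices H := by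
  intro v hv
  obtain ⟨u, p, hp, hv⟩ := mem_cycleVertices.1 hv
  exact mem_cycleVertices.2
    ⟨u, p.transfer H (edges_subset_of_le h p), hp.transfer _, by simpa using hv⟩

lemma cycleVertices_isolate_of_disjoint {G : SimpleGraph V} {S : Set V}
    (h : ∀ v ∈ S, v ∉ cycleVertices G) : cycleVertices (isolate G S) = cycleVertices G := by
  refine (cycleVertices_mono (isolate_le G S)).antisymm fun v hv => ?_
  obtain ⟨u, p, hp, hv⟩ := mem_cycleVertices.1 hv
  have := edges_subset_isolate (S := S) (p := p)
    fun w hw hS => h w hS (mem_cycleVertices_of_isCycle hp hw)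
  exact mem_cycleVertices.2 ⟨u, p.transfer _ this, hp.transfer _, by simpa using hv⟩

/-- A cycle that meets `p` passes through every vertex of `p`, so losing even one of them destroys
it; cycles that miss `p` are untouched. -/
lemma cycleVertices_isolate_of_isCycle {G : SimpleGraph V} (hG : CyclesSeparated G) {u : V}
    {p : G.Walk u u} (hp : p.IsCycle) {S : Set V} (hS : S ⊆ {w | w ∈ p.support})
    (hne : S.Nonempty) :
    cycleVertices (isolate G S) = cycleVertices G \ {w | w ∈ p.support} := by
  ext v
  constructor
  · intro hv
    refine ⟨cycleVertices_mono (isolate_le G S) hv, fun hvp => ?_⟩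
    obtain ⟨w, q, hq, hvq⟩ := mem_cycleVertices.1 hv
    obtain ⟨x, hx⟩ := hne
    have hle := edges_subset_of_le (isolate_le G S) q
    have := hG.mem_support hp (hq.transfer hle) (x := v) hvp (by simpa using hvq) (hS hx)
    exact notMem_of_isCycle_isolate hq (by simpa using this) hx
  · rintro ⟨hv, hvp⟩
    obtain ⟨w, q, hq, hvq⟩ := mem_cycleVertices.1 hv
    have := edges_subset_isolate (S := S) (p := q)
      fun y hy hyS => hvp (hG.mem_support hq hp hy (hS hyS) hvq)
    exact mem_cycleVertices.2 ⟨w, q.transfer _ this, hq.transfer _, by simpa using hvq⟩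

/-- Follow a walk from `s` until it first uses the deleted edge. Applied from both ends, this
controls how components merge. -/
lemma reachable_or_of_deleteEdges {G : SimpleGraph V} (x y : V) {s t : V} (h : G.Reachable s t) :
    (G.deleteEdges {s(x, y)}).Reachable s t ∨ (G.deleteEdges {s(x, y)}).Reachable s x ∨
      (G.deleteEdges {s(x, y)}).Reachable s y := by
  obtain ⟨p⟩ := h
  induction p using Walk.concatRec with
  | Hnil => exact Or.inl (Reachable.refl _)
  | Hconcat p h ih =>
    rename_i u v w
    rcases ih with ih | ih
    · by_cases he : s(v, w) = s(x, y)
      · rcases Sym2.eq_iff.1 he with ⟨rfl, rfl⟩ | ⟨rfl, rfl⟩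
        · exact Or.inr (Or.inl ih)
        · exact Or.inr (Or.inr ih)
      · refine Or.inl (ih.trans (Adj.reachable ?_))
        rw [deleteEdges_adj]
        exact ⟨h, by simpa using he⟩
    · exact Or.inr ih

/-- The part of the graph beyond an oriented edge. -/
def bridgeSide (G : SimpleGraph V) (a b : V) : Set V :=
  {w | (G.deleteEdges {s(a, b)}).Reachable b w}

/-- The inclusion is strict because `b` is not beyond the edge from `x` to `y`: it reaches `x`
without that bridge. -/
lemma bridgeSide_ssubset {G : SimpleGraph V} {a b x y : V}
    (hadj : G.Adj a b) (hxy : G.IsBridge s(x, y)) (hne : s(x, y) ≠ s(a, b))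
    (hadj' : G.Adj x y)
    (hx : ((G.deleteEdges {s(a, b)}).deleteEdges {s(x, y)}).Reachable b x) :
    bridgeSide G x y ⊂ bridgeSide G a b := by
  have hcomm : (G.deleteEdges {s(x, y)}).deleteEdges {s(a, b)} =
      (G.deleteEdges {s(a, b)}).deleteEdges {s(x, y)} := by
    rw [deleteEdges_deleteEdges, deleteEdges_deleteEdges, Set.union_comm]
  have hbx : (G.deleteEdges {s(x, y)}).Reachable b x :=
    hx.mono (by rw [← hcomm]; exact deleteEdges_le _)
  have hby : b ∉ bridgeSide G x y := fun h =>
    (isBridge_iff.1 hxy) ((h : (G.deleteEdges {s(x, y)}).Reachable y b).trans hbx).symm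
  have hyab : (G.deleteEdges {s(a, b)}).Reachable b y := by
    refine (hx.mono (deleteEdges_le _)).trans (Adj.reachable ?_)
    rw [deleteEdges_adj]
    exact ⟨hadj', by simpa using hne⟩
  have hyb : ¬ (G.deleteEdges {s(x, y)}).Reachable y b := hby
  have habx : (G.deleteEdges {s(x, y)}).Reachable a b := by
    refine Adj.reachable ?_
    rw [deleteEdges_adj]
    exact ⟨hadj, by simpa using hne.symm⟩
  refine ⟨fun w hw => ?_, fun h => hby (h (Reachable.refl b))⟩
  rcases reachable_or_of_deleteEdges a b (hw : (G.deleteEdges {s(x, y)}).Reachable y w)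
    with h | h | h
  · exact hyab.trans (h.mono (by rw [hcomm]; exact deleteEdges_le _))
  · exact absurd ((h.mono (deleteEdges_le _)).trans habx) hyb
  · exact absurd (h.mono (deleteEdges_le _)) hyb

/-- Descent on the far side: another bridge at a vertex beyond `s(a, b)`, oriented away from `b`,
has a strictly smaller far side. -/
lemma exists_terminal_bridge [Finite V] {G : SimpleGraph V} (a b : V) (hab : G.IsBridge s(a, b))
    (hadj : G.Adj a b) :
    ∃ a' b', G.IsBridge s(a', b') ∧ G.Adj a' b' ∧ bridgeSide G a' b' ⊆ bridgeSide G a b ∧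
      ∀ x ∈ bridgeSide G a' b', ∀ y, G.Adj x y → s(x, y) ≠ s(a', b') → IsCycleEdge G s(x, y) := by
  induction hS : bridgeSide G a b using WellFoundedLT.induction generalizing a b with
  | ind S ih =>
  subst hS
  by_cases hterm : ∀ x ∈ bridgeSide G a b, ∀ y, G.Adj x y → s(x, y) ≠ s(a, b) →
      IsCycleEdge G s(x, y)
  · exact ⟨a, b, hab, hadj, subset_rfl, hterm⟩
  push Not at hterm
  obtain ⟨x, hx, y, hxy, hne, hbr⟩ := hterm
  rw [isCycleEdge_iff hxy, not_not] at hbr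
  have key : ∃ x' y', G.IsBridge s(x', y') ∧ G.Adj x' y' ∧
      bridgeSide G x' y' < bridgeSide G a b := by
    have h2 : ((G.deleteEdges {s(a, b)}).deleteEdges {s(x, y)}).Reachable b x ∨
        ((G.deleteEdges {s(a, b)}).deleteEdges {s(x, y)}).Reachable b y := by
      rcases reachable_or_of_deleteEdges x y
        (hx : (G.deleteEdges {s(a, b)}).Reachable b x) with h | h | h
      · exact Or.inl h
      · exact Or.inl h
      · exact Or.inr h
    rcases h2 with h | h
    · exact ⟨x, y, hbr, hxy, bridgeSide_ssubset hadj hbr hne hxy h⟩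
    · rw [Sym2.eq_swap (a := x)] at hbr hne h
      exact ⟨y, x, hbr, hxy.symm, bridgeSide_ssubset hadj hbr hne hxy.symm h⟩
  obtain ⟨x', y', h1, h2, h3⟩ := key
  obtain ⟨a', b', h4, h5, h6, h7⟩ := ih _ h3 x' y' h1 h2 rfl
  exact ⟨a', b', h4, h5, h6.trans h3.le, h7⟩

/-- A vertex with exactly one neighbour. -/
def IsLeaf (G : SimpleGraph V) (u v : V) : Prop := G.Adj u v ∧ ∀ w, G.Adj u w → w = v

lemma exists_leaf_or_cycle [Finite V] {G : SimpleGraph V} {a b : V} (h : G.Adj a b) :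
    (∃ u v, IsLeaf G u v) ∨ (cycleVertices G).Nonempty := by
  by_cases hb : G.IsBridge s(a, b)
  · obtain ⟨a', b', h1, h2, -, h4⟩ := exists_terminal_bridge a b hb h
    by_cases hl : ∀ w, G.Adj b' w → w = a'
    · exact Or.inl ⟨b', a', h2.symm, hl⟩
    · push Not at hl
      obtain ⟨w, hw, hwa⟩ := hl
      right
      refine ⟨b', (h4 b' (Reachable.refl _) w hw ?_).mem_cycleVertices (by simp)⟩
      intro he
      rcases Sym2.eq_iff.1 he with ⟨h, -⟩ | ⟨-, h⟩
      · exact h2.ne h.symm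
      · exact hwa h
  · rw [← isCycleEdge_iff h] at hb
    exact Or.inr ⟨a, hb.mem_cycleVertices (by simp)⟩

end GraphBasics

/-! ### The cyclomatic number under deletion of edges and vertices -/

section Cyclomatic

variable {V : Type*} [Finite V]

lemma card_edgeSet_deleteEdges {G : SimpleGraph V} {e : Sym2 V} (he : e ∈ G.edgeSet) :
    Nat.card (G.deleteEdges {e}).edgeSet + 1 = Nat.card G.edgeSet := by
  rw [edgeSet_deleteEdges, Nat.card_coe_set_eq, Nat.card_coe_set_eq]
  exact Set.ncard_sdiff_singleton_add_one he (Set.toFinite _)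

lemma card_component_deleteEdges_of_not_isBridge {G : SimpleGraph V} {a b : V}
    (h : ¬ G.IsBridge s(a, b)) :
    Nat.card (G.deleteEdges {s(a, b)}).ConnectedComponent ≤ Nat.card G.ConnectedComponent := by
  rw [isBridge_iff, not_not] at h
  refine Nat.card_le_card_of_injective
    (ConnectedComponent.map (Hom.ofLE (deleteEdges_le (G := G) {s(a, b)}))) ?_
  intro C D
  induction C using ConnectedComponent.ind with | _ s
  induction D using ConnectedComponent.ind with | _ t
  intro hst
  simp only [ConnectedComponent.map_mk, Hom.coe_ofLE, id, ConnectedComponent.eq] at hst ⊢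
  rcases reachable_or_of_deleteEdges a b hst with h1 | h1 | h1
  · exact h1
  all_goals
    rcases reachable_or_of_deleteEdges a b hst.symm with h2 | h2 | h2
    · exact h2.symm
    · first | exact h1.trans h2.symm | exact h1.trans (h.symm.trans h2.symm)
    · first | exact h1.trans h2.symm | exact h1.trans (h.trans h2.symm)

lemma card_component_deleteEdges_le (G : SimpleGraph V) (a b : V) :
    Nat.card (G.deleteEdges {s(a, b)}).ConnectedComponent ≤ Nat.card G.ConnectedComponent + 1 := by
  set H := G.deleteEdges {s(a, b)} with hH
  have hle : H ≤ G := deleteEdges_le _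
  have hcard : Nat.card {C : H.ConnectedComponent // C ≠ H.connectedComponentMk b} + 1 =
      Nat.card H.ConnectedComponent := by
    have := Set.ncard_sdiff_singleton_add_one (Set.mem_univ (H.connectedComponentMk b))
      (Set.toFinite _)
    rw [Set.ncard_univ, ← Nat.card_coe_set_eq] at this
    rw [← this]
    congr 1
    exact Nat.card_congr (Equiv.subtypeEquivRight (by simp))
  rw [← hcard]
  -- Only the components of `a` and `b` can merge when the edge returns; with that of `b` left out,
  -- the map is injective.
  refine Nat.add_le_add_right (Nat.card_le_card_of_injective
    (fun C : {C : H.ConnectedComponent // C ≠ H.connectedComponentMk b} =>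
      ConnectedComponent.map (Hom.ofLE hle) C.1) ?_) 1
  rintro ⟨C, hC⟩ ⟨D, hD⟩ hst
  induction C using ConnectedComponent.ind with | _ s
  induction D using ConnectedComponent.ind with | _ t
  simp only [ConnectedComponent.map_mk, Hom.coe_ofLE, id, ConnectedComponent.eq, ne_eq,
    Subtype.mk.injEq] at hst hC hD ⊢
  rcases reachable_or_of_deleteEdges a b hst with h1 | h1 | h1
  · exact h1
  · rcases reachable_or_of_deleteEdges a b hst.symm with h2 | h2 | h2
    · exact h2.symm
    · exact h1.trans h2.symm
    · exact absurd h2 hD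
  · exact absurd h1 hC

lemma card_component_deleteEdges_of_isBridge {G : SimpleGraph V} {a b : V} (hadj : G.Adj a b)
    (h : G.IsBridge s(a, b)) :
    Nat.card G.ConnectedComponent + 1 ≤ Nat.card (G.deleteEdges {s(a, b)}).ConnectedComponent := by
  rw [isBridge_iff] at h
  set H := G.deleteEdges {s(a, b)} with hH
  have hle : H ≤ G := deleteEdges_le _
  have hcard : Nat.card {C : H.ConnectedComponent // C ≠ H.connectedComponentMk b} + 1 =
      Nat.card H.ConnectedComponent := by
    have := Set.ncard_sdiff_singleton_add_one (Set.mem_univ (H.connectedComponentMk b))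
      (Set.toFinite _)
    rw [Set.ncard_univ, ← Nat.card_coe_set_eq] at this
    rw [← this]
    congr 1
    exact Nat.card_congr (Equiv.subtypeEquivRight (by simp))
  rw [← hcard]
  refine Nat.add_le_add_right (Nat.card_le_card_of_surjective
    (fun C : {C : H.ConnectedComponent // C ≠ H.connectedComponentMk b} =>
      ConnectedComponent.map (Hom.ofLE hle) C.1) ?_) 1
  intro C
  induction C using ConnectedComponent.ind with | _ s
  by_cases hs : H.Reachable s b
  · refine ⟨⟨H.connectedComponentMk a, ?_⟩, ?_⟩
    · simpa using h
    · simp only [ConnectedComponent.map_mk, Hom.coe_ofLE, id, ConnectedComponent.eq]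
      exact hadj.reachable.trans (hs.mono hle).symm
  · exact ⟨⟨H.connectedComponentMk s, by simpa using hs⟩, rfl⟩

lemma cyclomaticNumber_deleteEdges_of_isCycleEdge {G : SimpleGraph V} {e : Sym2 V}
    (h : IsCycleEdge G e) :
    cyclomaticNumber (G.deleteEdges {e}) + 1 ≤ cyclomaticNumber G := by
  have he := h.mem_edgeSet
  rw [isCycleEdge_iff he] at h
  induction e with | _ a b
  have h1 := card_edgeSet_deleteEdges he
  have h2 := card_component_deleteEdges_of_not_isBridge h
  unfold cyclomaticNumber
  lia

lemma cyclomaticNumber_deleteEdges_le {G : SimpleGraph V} {e : Sym2 V} (he : e ∈ G.edgeSet) :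
    cyclomaticNumber (G.deleteEdges {e}) ≤ cyclomaticNumber G := by
  induction e with | _ a b
  have h1 := card_edgeSet_deleteEdges he
  have h2 := card_component_deleteEdges_le G a b
  unfold cyclomaticNumber
  lia

lemma le_cyclomaticNumber_deleteEdges {G : SimpleGraph V} {e : Sym2 V} (he : e ∈ G.edgeSet) :
    cyclomaticNumber G ≤ cyclomaticNumber (G.deleteEdges {e}) + 1 := by
  have h1 := card_edgeSet_deleteEdges he
  have h2 := ConnectedComponent.card_le_card_of_le (deleteEdges_le (G := G) {e})
  unfold cyclomaticNumber
  lia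

lemma le_cyclomaticNumber_deleteEdges_of_isBridge {G : SimpleGraph V} {e : Sym2 V}
    (he : e ∈ G.edgeSet) (h : G.IsBridge e) :
    cyclomaticNumber G ≤ cyclomaticNumber (G.deleteEdges {e}) := by
  induction e with | _ a b
  have h1 := card_edgeSet_deleteEdges he
  have h2 := card_component_deleteEdges_of_isBridge he h
  unfold cyclomaticNumber
  lia

omit [Finite V] in
lemma exists_edge_le_deleteEdges {G H : SimpleGraph V} (h : H < G) :
    ∃ e ∈ G.edgeSet, e ∉ H.edgeSet ∧ H ≤ G.deleteEdges {e} ∧ G.deleteEdges {e} < G := by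
  obtain ⟨e, he, heH⟩ := Set.exists_of_ssubset (edgeSet_strict_mono h)
  refine ⟨e, he, heH, ?_, ?_⟩
  · rw [← edgeSet_subset_edgeSet, edgeSet_deleteEdges]
    intro f hf
    exact ⟨edgeSet_mono h.le hf, fun hfe => heH (hfe ▸ hf)⟩
  · rw [← edgeSet_ssubset_edgeSet, edgeSet_deleteEdges]
    exact ⟨Set.sdiff_subset, fun hs => (hs he).2 rfl⟩

lemma cyclomaticNumber_mono {H G : SimpleGraph V} (h : H ≤ G) :
    cyclomaticNumber H ≤ cyclomaticNumber G := by
  induction G using WellFoundedLT.induction with | _ G ih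
  rcases h.eq_or_lt with rfl | hlt
  · exact le_rfl
  obtain ⟨e, he, -, h1, h2⟩ := exists_edge_le_deleteEdges hlt
  exact (ih _ h2 h1).trans (cyclomaticNumber_deleteEdges_le he)

lemma cyclomaticNumber_le_of_forall_isBridge {H G : SimpleGraph V} (h : H ≤ G)
    (hb : ∀ e ∈ G.edgeSet, e ∉ H.edgeSet → G.IsBridge e) :
    cyclomaticNumber G ≤ cyclomaticNumber H := by
  induction G using WellFoundedLT.induction with | _ G ih
  rcases h.eq_or_lt with rfl | hlt
  · exact le_rfl
  obtain ⟨e, he, heH, h1, h2⟩ := exists_edge_le_deleteEdges hlt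
  refine (le_cyclomaticNumber_deleteEdges_of_isBridge he (hb e he heH)).trans (ih _ h2 h1 ?_)
  intro f hf hfH
  exact (hb f (edgeSet_mono h2.le hf) hfH).anti h2.le

omit [Finite V] in
lemma cyclomaticNumber_bot : cyclomaticNumber (⊥ : SimpleGraph V) = 0 := by
  have h : Nat.card (⊥ : SimpleGraph V).ConnectedComponent = Nat.card V := by
    refine (Nat.card_eq_of_bijective (⊥ : SimpleGraph V).connectedComponentMk ⟨?_, ?_⟩).symm
    · intro a b hab
      simpa using hab
    · intro C
      induction C using ConnectedComponent.ind with | _ s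
      exact ⟨s, rfl⟩
  unfold cyclomaticNumber
  rw [h]
  simp

lemma cyclomaticNumber_isolate_of_mem_cycleVertices {G : SimpleGraph V} {v : V}
    (hv : v ∈ cycleVertices G) :
    cyclomaticNumber (isolate G {v}) + 1 ≤ cyclomaticNumber G := by
  obtain ⟨w, hw⟩ := exists_isCycleEdge_of_mem_cycleVertices hv
  refine le_trans ?_ (cyclomaticNumber_deleteEdges_of_isCycleEdge hw)
  gcongr
  refine cyclomaticNumber_mono fun a b hab => ?_
  rw [deleteEdges_adj]
  refine ⟨hab.1, fun he => ?_⟩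
  rcases Sym2.eq_iff.1 (Set.mem_singleton_iff.1 he) with ⟨rfl, -⟩ | ⟨-, rfl⟩
  · exact hab.2.1 rfl
  · exact hab.2.2 rfl

/-- If the deletion of any cycle vertex lowers the cyclomatic number by at most one, then distinct
cycles are disjoint. -/
lemma cyclesSeparated_of_cyclomaticNumber {G : SimpleGraph V}
    (h : ∀ v ∈ cycleVertices G, cyclomaticNumber G ≤ cyclomaticNumber (isolate G {v}) + 1) :
    CyclesSeparated G := by
  -- If `p` left `q` at `a` by an edge outside `q`, deleting that edge would lower the cyclomatic
  -- number, and deleting `a`, still on the cycle `q`, would lower it again: two units for one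
  -- vertex.
  have key : ∀ (w w' a z : V) (p : G.Walk w w) (q : G.Walk w' w'), p.IsCycle → q.IsCycle →
      a ∈ q.support → s(a, z) ∈ p.edges → s(a, z) ∈ q.edges := by
    intro w w' a z p q hp hq ha haz
    by_contra hne
    have h1 := cyclomaticNumber_deleteEdges_of_isCycleEdge ⟨w, p, hp, haz⟩
    have hle : ∀ e ∈ q.edges, e ∈ (G.deleteEdges {s(a, z)}).edgeSet := by
      intro e he
      rw [edgeSet_deleteEdges]
      exact ⟨q.edges_subset_edgeSet he, fun h => hne (Set.mem_singleton_iff.1 h ▸ he)⟩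
    have h2 := cyclomaticNumber_isolate_of_mem_cycleVertices
      (mem_cycleVertices_of_isCycle (hq.transfer hle) (v := a) (by simpa using ha))
    have h3 := h a (mem_cycleVertices_of_isCycle hq ha)
    have h4 : isolate (G.deleteEdges {s(a, z)}) {a} = isolate G {a} := by
      ext b c
      simp only [isolate_adj, deleteEdges_adj, Set.mem_singleton_iff, Sym2.eq_iff]
      tauto
    rw [h4] at h2
    lia
  -- Going along `p` from a common vertex, each step stays in `q`.
  have walk : ∀ (w w' : V) (p : G.Walk w w) (q : G.Walk w' w'), p.IsCycle → q.IsCycle →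
      ∀ (s t : V) (r : G.Walk s t), (∀ e ∈ r.edges, e ∈ p.edges) → s ∈ q.support →
        ∀ e ∈ r.edges, e ∈ q.edges := by
    intro w w' p q hp hq s t r
    induction r with
    | nil => simp
    | @cons a b _ hadj r ih =>
      intro hr hs e he
      have h1 := key w w' a b p q hp hq hs (hr s(a, b) (by simp))
      rcases List.mem_cons.1 (by simpa using he) with rfl | he
      · exact h1
      · exact ih (fun e he => hr e (by simp [he])) (q.snd_mem_support_of_mem_edges h1) e he
  intro u w x p q hp hq hxp hxq e he
  refine walk u w p q hp hq x x (p.rotate _ hxp) (fun e he => ?_) hxq e ?_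
  · exact (p.rotate_edges _ hxp).mem_iff.1 he
  · exact (p.rotate_edges _ hxp).mem_iff.2 he

end Cyclomatic

/-! ### Matchings as finite edge sets -/

section Matchings

variable {V : Type*}

/-- A matching, given as a finite set of pairwise disjoint edges. -/
def IsMatchingSet (G : SimpleGraph V) (M : Finset (Sym2 V)) : Prop :=
  (∀ e ∈ M, e ∈ G.edgeSet) ∧ ∀ e ∈ M, ∀ f ∈ M, ∀ w, w ∈ e → w ∈ f → e = f

/-- The vertices covered by a set of edges. -/
def coveredVertices (M : Finset (Sym2 V)) : Set V := {w | ∃ e ∈ M, w ∈ e}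

lemma coveredVertices_union (M N : Finset (Sym2 V)) :
    coveredVertices (M ∪ N) = coveredVertices M ∪ coveredVertices N := by
  ext w
  simp only [coveredVertices, Finset.mem_union, Set.mem_ofPred_eq, Set.mem_union]
  grind

lemma isMatchingSet_empty (G : SimpleGraph V) : IsMatchingSet G ∅ := by
  constructor <;> simp

lemma isMatchingSet_singleton {G : SimpleGraph V} {e : Sym2 V} (he : e ∈ G.edgeSet) :
    IsMatchingSet G {e} := by
  constructor <;> simp [he]

lemma IsMatchingSet.mono {G H : SimpleGraph V} (h : G ≤ H) {M : Finset (Sym2 V)}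
    (hM : IsMatchingSet G M) : IsMatchingSet H M :=
  ⟨fun e he => edgeSet_mono h (hM.1 e he), hM.2⟩

lemma IsMatchingSet.subset {G : SimpleGraph V} {M N : Finset (Sym2 V)}
    (hM : IsMatchingSet G M) (h : N ⊆ M) : IsMatchingSet G N :=
  ⟨fun e he => hM.1 e (h he), fun e he f hf => hM.2 e (h he) f (h hf)⟩

lemma IsMatchingSet.union {G : SimpleGraph V} {M N : Finset (Sym2 V)} (hM : IsMatchingSet G M)
    (hN : IsMatchingSet G N) (h : Disjoint (coveredVertices M) (coveredVertices N)) :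
    IsMatchingSet G (M ∪ N) := by
  rw [Set.disjoint_left] at h
  refine ⟨fun e he => (Finset.mem_union.1 he).elim (hM.1 e) (hN.1 e), ?_⟩
  intro e he f hf w hwe hwf
  rcases Finset.mem_union.1 he with he | he <;> rcases Finset.mem_union.1 hf with hf | hf
  · exact hM.2 e he f hf w hwe hwf
  · exact absurd ⟨f, hf, hwf⟩ (h ⟨e, he, hwe⟩)
  · exact absurd ⟨e, he, hwe⟩ (h ⟨f, hf, hwf⟩)
  · exact hN.2 e he f hf w hwe hwf

lemma card_union_of_disjoint_coveredVertices {M N : Finset (Sym2 V)}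
    (h : Disjoint (coveredVertices M) (coveredVertices N)) : (M ∪ N).card = M.card + N.card := by
  refine Finset.card_union_of_disjoint (Finset.disjoint_left.2 fun e heM heN => ?_)
  induction e with | _ a b
  exact Set.disjoint_left.1 h ⟨_, heM, Sym2.mem_mk_left a b⟩ ⟨_, heN, Sym2.mem_mk_left a b⟩

lemma IsMatchingSet.notMem_of_isolate {G : SimpleGraph V} {S : Set V} {M : Finset (Sym2 V)}
    (hM : IsMatchingSet (isolate G S) M) {w : V} (hw : w ∈ coveredVertices M) : w ∉ S := by
  obtain ⟨e, he, hwe⟩ := hw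
  obtain ⟨z, rfl⟩ := Sym2.mem_iff_exists.1 hwe
  exact (hM.1 _ he).2.1

lemma IsMatchingSet.isolate {G : SimpleGraph V} {S : Set V} {M : Finset (Sym2 V)}
    (hM : IsMatchingSet G M) (hS : ∀ w ∈ coveredVertices M, w ∉ S) :
    IsMatchingSet (isolate G S) M := by
  refine ⟨fun e he => ?_, hM.2⟩
  have h1 := hM.1 e he
  have h2 : ∀ w ∈ e, w ∉ S := fun w hw => hS w ⟨e, he, hw⟩
  induction e with | _ a b
  exact ⟨h1, h2 a (by simp), h2 b (by simp)⟩

variable [Finite V]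

omit [Finite V] in
lemma IsMatchingSet.ncard_coveredVertices {G : SimpleGraph V} {M : Finset (Sym2 V)}
    (hM : IsMatchingSet G M) : (coveredVertices M).ncard = 2 * M.card := by
  have h1 : coveredVertices M = ↑(M.biUnion Sym2.toFinset) := by
    ext w
    simp [coveredVertices]
  rw [h1, Set.ncard_coe_finset, Finset.card_biUnion]
  · rw [Finset.sum_congr rfl fun e he => Sym2.card_toFinset_of_not_isDiag e
      (not_isDiag_of_mem_edgeSet G (hM.1 e he))]
    simp [mul_comm]
  · intro e he f hf hne
    refine Finset.disjoint_left.2 fun w hwe hwf => ?_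
    exact hne (hM.2 e he f hf w (by simpa using hwe) (by simpa using hwf))

/-- Weak duality between matchings and covers. Intersecting with the covered vertices lets one cover
be charged separately on disjoint parts of the graph. -/
lemma IsMatchingSet.card_le_ncard_of_cover {G : SimpleGraph V} {M : Finset (Sym2 V)}
    (hM : IsMatchingSet G M) {S : Set V} (hS : ∀ e ∈ M, ∃ v ∈ S, v ∈ e) :
    M.card ≤ (S ∩ coveredVertices M).ncard := by
  have hS' : ∀ e, ∃ v, e ∈ M → v ∈ S ∧ v ∈ e := fun e => by
    by_cases he : e ∈ M
    · obtain ⟨v, hv⟩ := hS e he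
      exact ⟨v, fun _ => hv⟩
    · exact ⟨(Quot.out e).1, fun h => absurd h he⟩
  choose f hf using hS'
  rw [← Set.ncard_coe_finset M]
  refine Set.ncard_le_ncard_of_injOn f (fun e he => ⟨(hf e he).1, e, he, (hf e he).2⟩) ?_
    (Set.toFinite _)
  intro e he e' he' h
  exact hM.2 e he e' he' (f e) (hf e he).2 (h ▸ (hf e' he').2)

lemma bddAbove_matching (G : SimpleGraph V) :
    BddAbove {k : ℕ | ∃ M : G.Subgraph, M.IsMatching ∧ M.edgeSet.ncard = k} := by
  refine ⟨G.edgeSet.ncard, ?_⟩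
  rintro k ⟨M, -, rfl⟩
  exact Set.ncard_le_ncard (Subgraph.edgeSet_subset M) (Set.toFinite _)

lemma IsMatchingSet.card_le {G : SimpleGraph V} {M : Finset (Sym2 V)} (hM : IsMatchingSet G M) :
    M.card ≤ matchingNumber G := by
  let N : G.Subgraph :=
    { verts := coveredVertices M
      Adj := fun a b => s(a, b) ∈ M
      adj_sub := fun h => hM.1 _ h
      edge_vert := fun h => ⟨_, h, Sym2.mem_mk_left _ _⟩
      symm := ⟨fun a b h => Sym2.eq_swap (a := a) ▸ h⟩ }
  refine le_csSup (bddAbove_matching G) ⟨N, ?_, ?_⟩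
  · rintro v ⟨e, he, hve⟩
    obtain ⟨w, rfl⟩ := Sym2.mem_iff_exists.1 hve
    refine ⟨w, he, fun z hz => ?_⟩
    have := hM.2 _ he s(v, z) hz v (by simp) (by simp)
    exact (Sym2.congr_right.1 this).symm
  · have : N.edgeSet = ↑M := by
      ext e
      induction e with | _ a b
      rfl
    rw [this, Set.ncard_coe_finset]

lemma exists_isMatchingSet_card_eq (G : SimpleGraph V) :
    ∃ M, IsMatchingSet G M ∧ M.card = matchingNumber G := by
  obtain ⟨N, hN, hcard⟩ := Nat.sSup_mem (s := {k : ℕ | ∃ M : G.Subgraph, M.IsMatching ∧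
    M.edgeSet.ncard = k}) ⟨0, ⊥, by simp [Subgraph.IsMatching], by simp⟩ (bddAbove_matching G)
  refine ⟨(Set.toFinite N.edgeSet).toFinset, ⟨fun e he => ?_, ?_⟩, ?_⟩
  · exact N.edgeSet_subset (by simpa using he)
  · intro e he f hf w hwe hwf
    obtain ⟨a, rfl⟩ := Sym2.mem_iff_exists.1 hwe
    obtain ⟨b, rfl⟩ := Sym2.mem_iff_exists.1 hwf
    rw [Set.Finite.mem_toFinset, Subgraph.mem_edgeSet] at he hf
    rw [hN.eq_of_adj_left he hf]
  · rw [← Set.ncard_eq_toFinset_card]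
    exact hcard

lemma matchingNumber_le_isolate_add_one (G : SimpleGraph V) (v : V) :
    matchingNumber G ≤ matchingNumber (isolate G {v}) + 1 := by
  obtain ⟨M, hM, hcard⟩ := exists_isMatchingSet_card_eq G
  rw [← hcard, ← Finset.card_filter_add_card_filter_not (s := M) (fun e => v ∉ e)]
  refine Nat.add_le_add (IsMatchingSet.card_le ?_) ?_
  · refine (hM.subset (Finset.filter_subset _ _)).isolate ?_
    rintro w ⟨e, he, hwe⟩ rfl
    exact (Finset.mem_filter.1 he).2 hwe
  · rw [Finset.card_le_one]
    intro e he f hf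
    simp only [Finset.mem_filter, not_not] at he hf
    exact hM.2 e he.1 f hf.1 v he.2 hf.2

lemma two_mul_matchingNumber_le {G : SimpleGraph V} {S : Set V}
    (hS : ∀ a b, G.Adj a b → a ∈ S) : 2 * matchingNumber G ≤ S.ncard := by
  obtain ⟨M, hM, hcard⟩ := exists_isMatchingSet_card_eq G
  rw [← hcard, ← hM.ncard_coveredVertices]
  refine Set.ncard_le_ncard ?_ (Set.toFinite _)
  rintro w ⟨e, he, hwe⟩
  obtain ⟨z, rfl⟩ := Sym2.mem_iff_exists.1 hwe
  exact hS _ _ (hM.1 _ he)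

omit [Finite V] in
-- Take every other edge from the start. Here `n` counts edges, so an even `n` means an odd number
-- of vertices and the last one stays unmatched.
lemma exists_isMatchingSet_of_isPath {G : SimpleGraph V} :
    ∀ (n : ℕ) {u v : V} (p : G.Walk u v), p.length = n → p.IsPath →
      ∃ M, IsMatchingSet G M ∧ (∀ e ∈ M, e ∈ p.edges) ∧
        coveredVertices M = if Even n then {w | w ∈ p.support ∧ w ≠ v} else {w | w ∈ p.support} := by
  intro n
  induction n using Nat.strong_induction_on with | _ n ih
  intro u v p hn hp
  match p, hn with
  | .nil, hn =>
    refine ⟨∅, isMatchingSet_empty G, by simp, ?_⟩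
    ext w
    simp at hn
    subst hn
    simp [coveredVertices]
  | .cons (v := x) h .nil, hn =>
    refine ⟨{s(u, x)}, isMatchingSet_singleton h, by simp, ?_⟩
    ext w
    simp at hn
    subst hn
    simp [coveredVertices]
  | .cons (v := x) h (.cons h' q), hn =>
    simp only [Walk.length_cons] at hn
    rw [Walk.cons_isPath_iff, Walk.cons_isPath_iff] at hp
    obtain ⟨⟨hq, hx⟩, hu⟩ := hp
    simp only [Walk.support_cons, List.mem_cons, not_or] at hu
    obtain ⟨M, hM, hMe, hMc⟩ := ih q.length (by lia) q rfl hq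
    have hsub : coveredVertices M ⊆ {w | w ∈ q.support} := by
      rw [hMc]
      split_ifs
      · exact fun w hw => hw.1
      · exact subset_rfl
    have hd : Disjoint (coveredVertices {s(u, x)}) (coveredVertices M) := by
      rw [Set.disjoint_left]
      rintro w ⟨e, he, hwe⟩ hw
      rw [Finset.mem_singleton] at he
      subst he
      rcases Sym2.mem_iff.1 hwe with rfl | rfl
      · exact hu.2 (hsub hw)
      · exact hx (hsub hw)
    refine ⟨{s(u, x)} ∪ M, (isMatchingSet_singleton h).union hM hd, ?_, ?_⟩
    · intro e he
      rcases Finset.mem_union.1 he with he | he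
      · simp [Finset.mem_singleton.1 he]
      · simp [hMe e he]
    · have hpar : Even n ↔ Even q.length := by
        rw [← hn]; simp [Nat.even_add_one]
      have huv : u ≠ v := fun h => hu.2 (h ▸ q.end_mem_support)
      have hxv : x ≠ v := fun h => hx (h ▸ q.end_mem_support)
      rw [coveredVertices_union, hMc]
      simp only [hpar]
      ext w
      split_ifs
      · simp only [coveredVertices, Finset.mem_singleton, Set.mem_union, Set.mem_ofPred_eq,
          exists_eq_left, Sym2.mem_iff, Walk.support_cons, List.mem_cons]
        grind
      · simp only [coveredVertices, Finset.mem_singleton, Set.mem_union, Set.mem_ofPred_eq,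
          exists_eq_left, Sym2.mem_iff, Walk.support_cons, List.mem_cons]
        grind

omit [Finite V] in
lemma exists_isMatchingSet_of_isCycle {G : SimpleGraph V} {u : V} {p : G.Walk u u}
    (hp : p.IsCycle) (hl : Even p.length) :
    ∃ M, IsMatchingSet G M ∧ (∀ e ∈ M, e ∈ p.edges) ∧
      coveredVertices M = {w | w ∈ p.support} := by
  cases p with
  | nil => simp at hp
  | cons h q =>
    rw [Walk.cons_isCycle_iff] at hp
    obtain ⟨M, h1, h2, h3⟩ := exists_isMatchingSet_of_isPath _ q rfl hp.1
    rw [Walk.length_cons, Nat.even_add_one] at hl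
    refine ⟨M, h1, fun e he => by simp [h2 e he], ?_⟩
    rw [h3, if_neg hl]
    ext w
    have := q.end_mem_support
    simp only [Walk.support_cons, List.mem_cons, Set.mem_ofPred_eq]
    grind

omit [Finite V] in
lemma exists_isMatchingSet_of_odd_isCycle {G : SimpleGraph V} {u : V} {p : G.Walk u u}
    (hp : p.IsCycle) (hl : ¬ Even p.length) :
    ∃ M, IsMatchingSet G M ∧ (∀ e ∈ M, e ∈ p.edges) ∧
      coveredVertices M = {w | w ∈ p.support ∧ w ≠ u} := by
  cases p with
  | nil => simp at hp
  | cons h q =>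
    rw [Walk.cons_isCycle_iff] at hp
    obtain ⟨M, h1, h2, h3⟩ := exists_isMatchingSet_of_isPath _ q rfl hp.1
    rw [Walk.length_cons, Nat.even_add_one, not_not] at hl
    refine ⟨M, h1, fun e he => by simp [h2 e he], ?_⟩
    rw [h3, if_pos hl]
    ext w
    have := q.end_mem_support
    simp only [Walk.support_cons, List.mem_cons, Set.mem_ofPred_eq]
    grind

omit [Finite V] in
/-- In an even cycle, the vertices other than two consecutive ones can be matched. -/
lemma exists_isMatchingSet_of_isCycle_diff {G : SimpleGraph V} {u : V} {p : G.Walk u u}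
    (hp : p.IsCycle) (hl : Even p.length) :
    ∃ M, IsMatchingSet G M ∧ (∀ e ∈ M, e ∈ p.edges) ∧
      coveredVertices M = {w | w ∈ p.support ∧ w ≠ u ∧ w ≠ p.snd} := by
  match p with
  | .nil => simp at hp
  | .cons h .nil => exact absurd h (by simp)
  | .cons (v := x) h (.cons h' q) =>
    rw [Walk.cons_isCycle_iff, Walk.cons_isPath_iff] at hp
    obtain ⟨M, h1, h2, h3⟩ := exists_isMatchingSet_of_isPath _ q rfl hp.1.1
    have hl' : Even q.length := by
      simpa [Nat.even_add_one] using hl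
    refine ⟨M, h1, fun e he => by simp [h2 e he], ?_⟩
    rw [h3, if_pos hl']
    ext w
    have := hp.1.2
    simp only [Walk.support_cons, List.mem_cons, Set.mem_ofPred_eq, Walk.snd_cons]
    grind

omit [Finite V] in
lemma ncard_support_of_isCycle {G : SimpleGraph V} {u : V} {p : G.Walk u u}
    (hp : p.IsCycle) : {w | w ∈ p.support}.ncard = p.length := by
  cases p with
  | nil => simp at hp
  | cons h q =>
    rw [Walk.cons_isCycle_iff] at hp
    have : {w | w ∈ (Walk.cons h q).support} = ↑q.support.toFinset := by
      ext w
      have := q.end_mem_support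
      simp only [Walk.support_cons, List.mem_cons, Set.mem_ofPred_eq, List.coe_toFinset]
      grind
    rw [this, Set.ncard_coe_finset, List.toFinset_card_of_nodup hp.1.support_nodup]
    simp

/-- If the cycles are disjoint and even, then the cycle vertices can be perfectly matched. -/
lemma exists_isMatchingSet_cycleVertices {G : SimpleGraph V} (hG : CyclesSeparated G)
    (heven : ∀ (u : V) (p : G.Walk u u), p.IsCycle → Even p.length) :
    ∃ M, IsMatchingSet G M ∧ coveredVertices M = cycleVertices G := by
  induction G using WellFoundedLT.induction with | _ G ih
  by_cases hne : (cycleVertices G).Nonempty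
  · obtain ⟨v, hv⟩ := hne
    obtain ⟨u, p, hp, hv⟩ := mem_cycleVertices.1 hv
    obtain ⟨w, hw⟩ := exists_edge_of_mem_support hp hv
    have hle := isolate_le G {w | w ∈ p.support}
    obtain ⟨M, hM, hMc⟩ := ih _ (isolate_lt (p.adj_of_mem_edges hw) hv) (hG.anti hle)
      fun u q hq => by
        have := heven u (q.transfer G (edges_subset_of_le hle q)) (hq.transfer _)
        simpa using this
    rw [cycleVertices_isolate_of_isCycle hG hp subset_rfl ⟨v, hv⟩] at hMc
    obtain ⟨N, hN, -, hNc⟩ := exists_isMatchingSet_of_isCycle hp (heven u p hp)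
    refine ⟨M ∪ N, (hM.mono hle).union hN ?_, ?_⟩
    · rw [hMc, hNc]
      exact Set.disjoint_sdiff_left
    · rw [coveredVertices_union, hMc, hNc]
      exact Set.sdiff_union_of_subset fun x hx => mem_cycleVertices_of_isCycle hp hx
  · refine ⟨∅, isMatchingSet_empty G, ?_⟩
    rw [Set.not_nonempty_iff_eq_empty.1 hne]
    simp [coveredVertices]

end Matchings

/-! ### Rank and kernel under vertex deletion; gains of walks -/

section Rank

variable {V : Type*} [Fintype V]

/-- The Hermitian adjacency matrix of a graph whose gains are given on all pairs of vertices. -/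
noncomputable def gainMatrix (g : V → V → Circle) (G : SimpleGraph V) : Matrix V V ℂ :=
  Matrix.of fun i j => if G.Adj i j then (g i j : ℂ) else 0

/-- The rank of the Hermitian adjacency matrix. -/
noncomputable def gainRank (g : V → V → Circle) (G : SimpleGraph V) : ℕ :=
  (gainMatrix g G).rank

lemma gainMatrix_mulVec (g : V → V → Circle) (G : SimpleGraph V) (x : V → ℂ) (i : V) :
    (gainMatrix g G).mulVec x i = ∑ j, if G.Adj i j then (g i j : ℂ) * x j else 0 := by
  simp [gainMatrix, Matrix.mulVec, dotProduct, ite_mul]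

/-- The diagonal projection that kills the coordinates in a set. -/
noncomputable def killMatrix (S : Set V) : Matrix V V ℂ :=
  Matrix.diagonal fun v => if v ∈ S then 0 else 1

lemma gainMatrix_isolate (g : V → V → Circle) (G : SimpleGraph V) (S : Set V) :
    gainMatrix g (isolate G S) = killMatrix S * gainMatrix g G * killMatrix S := by
  ext i j
  simp only [killMatrix, Matrix.mul_diagonal, Matrix.diagonal_mul, gainMatrix, Matrix.of_apply,
    isolate_adj]
  by_cases hi : i ∈ S <;> by_cases hj : j ∈ S <;> simp [hi, hj]

lemma gainRank_isolate_le (g : V → V → Circle) (G : SimpleGraph V) (S : Set V) :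
    gainRank g (isolate G S) ≤ gainRank g G := by
  unfold gainRank
  rw [gainMatrix_isolate]
  exact (Matrix.rank_mul_le_left _ _).trans (Matrix.rank_mul_le_right _ _)

lemma matrix_rank_add_le (A B : Matrix V V ℂ) : (A + B).rank ≤ A.rank + B.rank := by
  unfold Matrix.rank
  rw [Matrix.mulVecLin_add]
  exact (Submodule.finrank_mono (LinearMap.range_add_le _ _)).trans
    (Submodule.finrank_add_le_finrank_add_finrank _ _)

lemma rank_le_of_forall_notMem_row_eq {A B : Matrix V V ℂ} {S : Set V}
    (h : ∀ i ∉ S, ∀ j, A i j = B i j) : A.rank ≤ B.rank + S.ncard := by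
  have h1 : A = B + (A - B) := by abel
  rw [h1]
  refine (matrix_rank_add_le _ _).trans (Nat.add_le_add_left ?_ _)
  have := Matrix.rank_le_card_of_support_subset (A - B) S.toFinset fun i hi => by
    by_contra hiS
    apply hi
    ext j
    have := h i (by simpa using hiS) j
    simp [this]
  rwa [← Set.ncard_eq_toFinset_card'] at this

lemma gainRank_le_isolate_add (g : V → V → Circle) (G : SimpleGraph V) (S : Set V) :
    gainRank g G ≤ gainRank g (isolate G S) + 2 * S.ncard := by
  unfold gainRank
  rw [gainMatrix_isolate]
  have h1 : (gainMatrix g G).rank ≤ (killMatrix S * gainMatrix g G).rank + S.ncard :=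
    rank_le_of_forall_notMem_row_eq fun i hi j => by simp [killMatrix, Matrix.diagonal_mul, hi]
  have h2 : (killMatrix S * gainMatrix g G).rank ≤
      (killMatrix S * gainMatrix g G * killMatrix S).rank + S.ncard := by
    rw [← Matrix.rank_transpose, ← Matrix.rank_transpose (killMatrix S * gainMatrix g G * killMatrix S)]
    refine rank_le_of_forall_notMem_row_eq fun i hi j => ?_
    simp [killMatrix, Matrix.mul_diagonal, hi]
  lia

lemma gainRank_add_finrank_ker (g : V → V → Circle) (G : SimpleGraph V) :
    gainRank g G + Module.finrank ℂ (LinearMap.ker (gainMatrix g G).mulVecLin) =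
      Fintype.card V := by
  have := LinearMap.finrank_range_add_finrank_ker (gainMatrix g G).mulVecLin
  rwa [Module.finrank_fintype_fun_eq_card] at this

lemma gainMatrix_isolate_mulVec_eq_zero {g : V → V → Circle} {G : SimpleGraph V} {v : V}
    {x : V → ℂ} (hx : (gainMatrix g G).mulVec x = 0) (hxv : x v = 0) :
    (gainMatrix g (isolate G {v})).mulVec x = 0 := by
  ext i
  have hi := congrFun hx i
  rw [gainMatrix_mulVec] at hi ⊢
  by_cases hiv : i = v
  · subst hiv
    simp [isolate_adj]
  · rw [← hi]
    refine Finset.sum_congr rfl fun j _ => ?_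
    by_cases hj : j = v
    · subst hj
      simp [hxv]
    · simp [isolate_adj, hiv, hj]

lemma ker_le_ker_isolate {g : V → V → Circle} {G : SimpleGraph V} {v : V}
    (h : ∀ x ∈ LinearMap.ker (gainMatrix g G).mulVecLin, x v = 0) :
    LinearMap.ker (gainMatrix g G).mulVecLin ≤
      LinearMap.ker (gainMatrix g (isolate G {v})).mulVecLin :=
  fun x hx => gainMatrix_isolate_mulVec_eq_zero hx (h x hx)

lemma single_mem_ker {g : V → V → Circle} {G : SimpleGraph V} {v : V} (hv : ∀ w, ¬ G.Adj w v) :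
    Pi.single v 1 ∈ LinearMap.ker (gainMatrix g G).mulVecLin := by
  rw [LinearMap.mem_ker, Matrix.mulVecLin_apply]
  ext i
  simp [gainMatrix, hv]

/-- If deleting a vertex keeps the rank, some kernel vector does not vanish there. -/
lemma exists_ker_ne_zero {g : V → V → Circle} {G : SimpleGraph V} {v : V}
    (h : gainRank g (isolate G {v}) = gainRank g G) :
    ∃ x : V → ℂ, (gainMatrix g G).mulVec x = 0 ∧ x v ≠ 0 := by
  by_contra hne
  push Not at hne
  have hle := ker_le_ker_isolate (g := g) (G := G) (v := v) fun x hx => hne x hx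
  have h1 := gainRank_add_finrank_ker g G
  have h2 := gainRank_add_finrank_ker g (isolate G {v})
  -- Equal ranks make the two kernels equal, yet the unit vector at `v` lies in the kernel after
  -- deletion and does not vanish at `v`.
  have heq := Submodule.eq_of_le_of_finrank_eq hle (by lia)
  have hmem : Pi.single v 1 ∈ LinearMap.ker (gainMatrix g G).mulVecLin := by
    rw [heq]
    exact single_mem_ker fun w hw => hw.2.2 rfl
  have := hne _ hmem
  simp at this

/-- If some kernel vector does not vanish at a vertex, deleting the vertex keeps the rank. -/
lemma gainRank_le_isolate_of_ker {g : V → V → Circle} (hg : ∀ a b, g b a = (g a b)⁻¹)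
    {G : SimpleGraph V} {v : V} {x : V → ℂ} (hx : (gainMatrix g G).mulVec x = 0) (hxv : x v ≠ 0) :
    gainRank g G ≤ gainRank g (isolate G {v}) := by
  have hherm : (gainMatrix g G).conjTranspose = gainMatrix g G := by
    ext i j
    simp only [Matrix.conjTranspose_apply, gainMatrix, Matrix.of_apply, G.adj_comm j i]
    split_ifs
    · rw [hg i j, Circle.coe_inv_eq_conj]
      simp
    · simp
  set A := gainMatrix g G with hA
  -- `E` is the projection along `x` onto the vectors vanishing at `v`. As `x` is in the kernel, `A`
  -- equals its compression by `E`, which factors through the matrix with row and column `v` killed.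
  set E : Matrix V V ℂ := 1 - Matrix.vecMulVec x (Pi.single v (x v)⁻¹) with hE
  have hAE : A * E = A := by
    rw [hE, mul_sub, mul_one, Matrix.mul_vecMulVec, hx]
    simp
  have hEA : E.conjTranspose * A = A := by
    have := congrArg Matrix.conjTranspose hAE
    rwa [Matrix.conjTranspose_mul, hherm] at this
  have hEk : killMatrix {v} * E = E := by
    ext i j
    simp only [killMatrix, Matrix.diagonal_mul, hE, Matrix.sub_apply, Matrix.vecMulVec_apply]
    by_cases hi : i = v
    · subst hi
      by_cases hj : j = i
      · subst hj
        simp [hxv]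
      · simp [hj, Ne.symm hj]
    · simp [hi]
  have hkE : E.conjTranspose * killMatrix {v} = E.conjTranspose := by
    have := congrArg Matrix.conjTranspose hEk
    rw [Matrix.conjTranspose_mul] at this
    convert this using 2
    ext i j
    simp only [killMatrix, Matrix.conjTranspose_apply, Matrix.diagonal_apply]
    by_cases hij : i = j
    · subst hij
      split_ifs <;> simp
    · simp [hij, Ne.symm hij]
  have : A = E.conjTranspose * (killMatrix {v} * A * killMatrix {v}) * E := by
    calc A = E.conjTranspose * A * E := by rw [hEA, hAE]
      _ = (E.conjTranspose * killMatrix {v}) * A * (killMatrix {v} * E) := by rw [hEk, hkE]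
      _ = _ := by simp only [Matrix.mul_assoc]
  unfold gainRank
  rw [gainMatrix_isolate, ← hA]
  conv_lhs => rw [this]
  exact (Matrix.rank_mul_le_left _ _).trans (Matrix.rank_mul_le_right _ _)

/-- The row of the leaf `u` forces kernel vectors to vanish at `v`, so the kernel survives the
deletion; the unit vectors at `u` and `v` then enlarge it by two dimensions. -/
lemma gainRank_isolate_leaf_add_two_le {g : V → V → Circle} {G : SimpleGraph V} {u v : V}
    (h : IsLeaf G u v) : gainRank g (isolate G {v}) + 2 ≤ gainRank g G := by
  have hker : ∀ x ∈ LinearMap.ker (gainMatrix g G).mulVecLin, x v = 0 := by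
    intro x hx
    rw [LinearMap.mem_ker, Matrix.mulVecLin_apply] at hx
    have := congrFun hx u
    rw [gainMatrix_mulVec, Finset.sum_eq_single v] at this
    · simpa [h.1] using this
    · intro j _ hj
      rw [if_neg fun hu => hj (h.2 j hu)]
    · simp
  have hle := ker_le_ker_isolate hker
  have h5 := gainRank_add_finrank_ker g G
  have h6 := gainRank_add_finrank_ker g (isolate G {v})
  set K := LinearMap.ker (gainMatrix g G).mulVecLin
  set K' := LinearMap.ker (gainMatrix g (isolate G {v})).mulVecLin
  have hv : Pi.single v 1 ∈ K' := single_mem_ker fun w hw => hw.2.2 rfl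
  have hu : Pi.single u 1 ∈ K' := single_mem_ker fun w hw => hw.2.1 (h.2 w hw.1.symm)
  have h1 : K < K ⊔ Submodule.span ℂ {Pi.single u 1} := by
    refine lt_of_le_not_ge le_sup_left fun hK => ?_
    have hmem : (Pi.single u 1 : V → ℂ) ∈ K :=
      hK (Submodule.mem_sup_right (Submodule.mem_span_singleton_self _))
    rw [LinearMap.mem_ker, Matrix.mulVecLin_apply] at hmem
    have := congrFun hmem v
    simp [gainMatrix, h.1.symm] at this
  have h2 : K ⊔ Submodule.span ℂ {Pi.single u 1} < K' := by
    refine lt_of_le_not_ge (sup_le hle (by simpa [Submodule.span_le] using hu)) fun hK => ?_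
    obtain ⟨y, hy, z, hz, hyz⟩ := Submodule.mem_sup.1 (hK hv)
    obtain ⟨c, rfl⟩ := Submodule.mem_span_singleton.1 hz
    have := congrFun hyz v
    simp [hker y hy, h.1.ne] at this
  have h3 := Submodule.finrank_lt_finrank_of_lt h1
  have h4 := Submodule.finrank_lt_finrank_of_lt h2
  omega

/-- The product of the gains along a walk. -/
noncomputable def gainProd (g : V → V → Circle) {G : SimpleGraph V} {u v : V} (p : G.Walk u v) :
    Circle := (p.darts.map fun d => g d.fst d.snd).prod

omit [Fintype V] in
lemma gainProd_cons (g : V → V → Circle) {G : SimpleGraph V} {u v w : V} (h : G.Adj u v)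
    (p : G.Walk v w) : gainProd g (Walk.cons h p) = g u v * gainProd g p := by
  simp [gainProd]

omit [Fintype V] in
lemma gainProd_eq (g : V → V → Circle) {G : SimpleGraph V} {u v : V} (p : G.Walk u v) :
    gainProd g p = ∏ i ∈ Finset.range p.length, g (p.getVert i) (p.getVert (i + 1)) := by
  induction p with
  | nil => simp [gainProd]
  | cons h p ih =>
    rw [Walk.length_cons, Finset.prod_range_succ', gainProd_cons, ih, mul_comm]
    simp

omit [Fintype V] in
lemma gainProd_transfer (g : V → V → Circle) {G H : SimpleGraph V} {u v : V} (p : G.Walk u v)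
    (hp : ∀ e ∈ p.edges, e ∈ H.edgeSet) : gainProd g (p.transfer H hp) = gainProd g p := by
  induction p with
  | nil => rfl
  | cons h p ih =>
    have := ih fun e he => hp e (by simp [he])
    rw [gainProd_cons, ← this]
    exact gainProd_cons g _ _

end Rank

/-! ### Kernel vectors on an isolated even cycle -/

section CycleRank

variable {V : Type*}

/-- No edge leaves the vertex set of a cycle, nor is any of its chords present. -/
def IsIsolatedCycle {G : SimpleGraph V} {u : V} (p : G.Walk u u) : Prop :=
  p.IsCycle ∧ ∀ w ∈ p.support, ∀ z, G.Adj w z → s(w, z) ∈ p.edges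

lemma IsIsolatedCycle.adj_iff {G : SimpleGraph V} {u : V} {p : G.Walk u u}
    (h : IsIsolatedCycle p) {w : V} (hw : w ∈ p.support) (z : V) :
    G.Adj w z ↔ z ∈ p.toSubgraph.neighborSet w := by
  rw [Subgraph.mem_neighborSet, ← Subgraph.mem_edgeSet, Walk.edgeSet_toSubgraph]
  exact ⟨h.2 w hw z, fun he => p.adj_of_mem_edges he⟩

lemma IsIsolatedCycle.adj_getVert {G : SimpleGraph V} {u : V} {p : G.Walk u u}
    (h : IsIsolatedCycle p) {i : ℕ} (h0 : i ≠ 0) (hi : i < p.length) (z : V) :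
    G.Adj (p.getVert i) z ↔ z = p.getVert (i - 1) ∨ z = p.getVert (i + 1) := by
  rw [h.adj_iff (p.getVert_mem_support i), h.1.neighborSet_toSubgraph_internal h0 hi]
  simp

lemma IsIsolatedCycle.adj_start {G : SimpleGraph V} {u : V} {p : G.Walk u u}
    (h : IsIsolatedCycle p) (z : V) :
    G.Adj u z ↔ z = p.penultimate ∨ z = p.snd := by
  rw [h.adj_iff p.start_mem_support, h.1.neighborSet_toSubgraph_endpoint, or_comm]
  simp

variable [Fintype V]

lemma gainMatrix_mulVec_of_adj_iff {g : V → V → Circle} {G : SimpleGraph V} {w a b : V}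
    (hab : a ≠ b) (h : ∀ z, G.Adj w z ↔ z = a ∨ z = b) (x : V → ℂ) :
    (gainMatrix g G).mulVec x w = g w a * x a + g w b * x b := by
  rw [gainMatrix_mulVec, ← Finset.sum_filter,
    show Finset.univ.filter (fun j => G.Adj w j) = {a, b} by ext z; simp [h],
    Finset.sum_pair hab]

lemma IsIsolatedCycle.mulVec_getVert {g : V → V → Circle} {G : SimpleGraph V} {u : V}
    {p : G.Walk u u} (h : IsIsolatedCycle p) {i : ℕ} (h0 : i ≠ 0) (hi : i < p.length) (x : V → ℂ) :
    (gainMatrix g G).mulVec x (p.getVert i) =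
      g (p.getVert i) (p.getVert (i - 1)) * x (p.getVert (i - 1)) +
        g (p.getVert i) (p.getVert (i + 1)) * x (p.getVert (i + 1)) :=
  gainMatrix_mulVec_of_adj_iff (h.1.getVert_sub_one_ne_getVert_add_one hi.le)
    (h.adj_getVert h0 hi) x

/-- The gain of an isolated even cycle is determined by a kernel vector that does not vanish on
it. -/
lemma IsIsolatedCycle.gainProd_eq_of_ker {g : V → V → Circle} (hg : ∀ a b, g b a = (g a b)⁻¹)
    {G : SimpleGraph V} {u : V} {p : G.Walk u u} (h : IsIsolatedCycle p) (hl : Even p.length)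
    {x : V → ℂ} (hx : (gainMatrix g G).mulVec x = 0) (hxu : x u ≠ 0) :
    (gainProd g p : ℂ) = (-1) ^ (p.length / 2) := by
  -- Only the rows at odd positions are needed: each relates the two neighbouring even positions and
  -- contributes a factor -1. The last even position is `u` again.
  have key : ∀ j, 2 * j ≤ p.length →
      ((∏ i ∈ Finset.range (2 * j), g (p.getVert i) (p.getVert (i + 1)) : Circle) : ℂ) *
        x (p.getVert (2 * j)) = (-1) ^ j * x u := by
    intro j
    induction j with
    | zero => simp
    | succ j ih =>
      intro hj
      have h1 := ih (by lia)
      have h2 := h.mulVec_getVert (g := g) (i := 2 * j + 1) (by lia) (by lia) x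
      rw [hx, hg (p.getVert (2 * j + 1 - 1))] at h2
      simp only [Pi.zero_apply, Nat.add_sub_cancel, Circle.coe_inv] at h2
      rw [show 2 * (j + 1) = 2 * j + 1 + 1 by ring, Finset.prod_range_succ,
        Finset.prod_range_succ, Circle.coe_mul, Circle.coe_mul, pow_succ]
      have h3 : (g (p.getVert (2 * j)) (p.getVert (2 * j + 1)) : ℂ) ≠ 0 := Circle.coe_ne_zero _
      field_simp at h2
      linear_combination
        -((∏ i ∈ Finset.range (2 * j), g (p.getVert i) (p.getVert (i + 1)) : Circle) : ℂ) * h2 - h1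
  obtain ⟨m, hm⟩ := hl
  have := key m (by lia)
  rw [show 2 * m = p.length by lia, ← gainProd_eq, Walk.getVert_length] at this
  rw [mul_right_cancel₀ hxu this]
  congr 1
  lia

/-- Multiply by `s` over the gain at each step. Every row then reads a multiple of 1 + s² = 0, and
the values close up because s to the power of the length equals the gain of the cycle. -/
lemma IsIsolatedCycle.exists_ker {g : V → V → Circle} (hg : ∀ a b, g b a = (g a b)⁻¹)
    {G : SimpleGraph V} {u : V} {p : G.Walk u u} (h : IsIsolatedCycle p) (hl : Even p.length)
    (hp : (gainProd g p : ℂ) = (-1) ^ (p.length / 2)) {s : ℂ} (hs : s * s = -1) :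
    ∃ x : V → ℂ, (gainMatrix g G).mulVec x = 0 ∧ x u = 1 ∧ x p.snd = s * (g u p.snd : ℂ)⁻¹ := by
  have h3 := h.1.three_le_length
  let P : ℕ → Circle := fun k => ∏ i ∈ Finset.range k, g (p.getVert i) (p.getVert (i + 1))
  let a : ℕ → ℂ := fun k => s ^ k * (P k : ℂ)⁻¹
  have ha0 : a 0 = 1 := by simp [a, P]
  have hal : a p.length = 1 := by
    obtain ⟨m, hm⟩ := hl
    simp only [a, P]
    rw [← gainProd_eq, hp, hm, pow_add, ← mul_pow, hs, show (m + m) / 2 = m by lia]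
    exact mul_inv_cancel₀ (by simp)
  have hsucc : ∀ k, a (k + 1) = s * (g (p.getVert k) (p.getVert (k + 1)) : ℂ)⁻¹ * a k := by
    intro k
    simp only [a, P]
    rw [Finset.prod_range_succ, Circle.coe_mul, mul_inv, pow_succ]
    ring
  -- Positions 0 and `p.length` are the only ones that share a vertex, and `a` is 1 at both.
  have hinj : ∀ i ≤ p.length, ∀ k ≤ p.length, p.getVert i = p.getVert k → a i = a k := by
    have hred : ∀ i ≤ p.length, ∃ i' < p.length, p.getVert i' = p.getVert i ∧ a i' = a i := by
      intro i hi
      rcases hi.lt_or_eq with hi | rfl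
      · exact ⟨i, hi, rfl, rfl⟩
      · exact ⟨0, by lia, by simp, by rw [ha0, hal]⟩
    intro i hi k hk hik
    obtain ⟨i', hi', h1, h2⟩ := hred i hi
    obtain ⟨k', hk', h4, h5⟩ := hred k hk
    rw [← h2, ← h5, h.1.getVert_injOn' (show i' ≤ p.length - 1 by lia)
      (show k' ≤ p.length - 1 by lia) (by rw [h1, h4, hik])]
  let f : V → ℂ := fun w => if hw : w ∈ p.support then
    a (Walk.mem_support_iff_exists_getVert.1 hw).choose else 0
  have hf : ∀ k ≤ p.length, f (p.getVert k) = a k := by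
    intro k hk
    have hmem := p.getVert_mem_support k
    have hc := (Walk.mem_support_iff_exists_getVert.1 hmem).choose_spec
    simp only [f, dif_pos hmem]
    exact hinj _ hc.2 _ hk hc.1
  have hfn : ∀ w ∉ p.support, f w = 0 := fun w hw => by simp only [f, dif_neg hw]
  -- The next vertex `d` is left free so that the row at `u`, where the index wraps around to
  -- `p.snd`, is covered too.
  have hrow : ∀ k, k + 2 ≤ p.length + 1 → ∀ b c d : V, b = p.getVert k → c = p.getVert (k + 1) →
      f d = s * (g c d : ℂ)⁻¹ * f c → (g c b : ℂ) * f b + g c d * f d = 0 := by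
    rintro k hk b c d rfl rfl hd
    rw [hd, hf k (by lia), hf (k + 1) (by lia), hsucc, hg (p.getVert k), Circle.coe_inv]
    have h1 : (g (p.getVert (k + 1)) d : ℂ) ≠ 0 := Circle.coe_ne_zero _
    field_simp
    linear_combination (a k) * hs
  refine ⟨f, ?_, ?_, ?_⟩
  · ext w
    rw [Pi.zero_apply]
    by_cases hw : w ∈ p.support
    · obtain ⟨i, rfl, hi⟩ := Walk.mem_support_iff_exists_getVert.1 hw
      by_cases hi' : i = 0 ∨ i = p.length
      · have hiu : p.getVert i = u := (h.1.getVert_endpoint_iff hi).2 hi'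
        rw [hiu, gainMatrix_mulVec_of_adj_iff h.1.snd_ne_penultimate.symm h.adj_start]
        refine hrow (p.length - 1) (by lia) _ _ _ rfl ?_ ?_
        · rw [show p.length - 1 + 1 = p.length by lia, Walk.getVert_length]
        · have h1 := hsucc 0
          rw [← hf 0 (by lia), ← hf (0 + 1) (by lia)] at h1
          simpa using h1
      · push Not at hi'
        rw [h.mulVec_getVert hi'.1 (by lia)]
        refine hrow (i - 1) (by lia) _ _ _ rfl (by congr 1; lia) ?_
        rw [hf i hi, hf (i + 1) (by lia), hsucc]
    · rw [gainMatrix_mulVec]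
      refine Finset.sum_eq_zero fun j _ => ?_
      split_ifs with hadj
      · rw [hfn j fun hj => hw (p.snd_mem_support_of_mem_edges (h.2 j hj w hadj.symm)), mul_zero]
      · rfl
  · have := hf 0 (by lia)
    rwa [Walk.getVert_zero, ha0] at this
  · have := hf 1 (by lia)
    have h1 := hsucc 0
    rw [ha0] at h1
    rw [h1] at this
    simpa using this

/-- The kernel vectors for `s` = ±i allow two consecutive vertices to be deleted without loss of
rank; the other vertices of the cycle contribute at most one row each. -/
lemma IsIsolatedCycle.gainRank_le {g : V → V → Circle} (hg : ∀ a b, g b a = (g a b)⁻¹)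
    {G : SimpleGraph V} {u : V} {p : G.Walk u u} (h : IsIsolatedCycle p) (hl : Even p.length)
    (hp : (gainProd g p : ℂ) = (-1) ^ (p.length / 2)) :
    gainRank g G + 2 ≤ gainRank g (isolate G {w | w ∈ p.support}) + p.length := by
  obtain ⟨x, hx, hxu, hxs⟩ := h.exists_ker hg hl hp Complex.I_mul_I
  obtain ⟨y, hy, hyu, hys⟩ := h.exists_ker hg hl hp (s := -Complex.I) (by simp)
  have hadj := p.adj_snd h.1.not_nil
  have h1 := gainRank_le_isolate_of_ker hg hx (v := u) (by simp [hxu])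
  -- Both vectors are 1 at `u`, so their difference stays in the kernel once `u` is deleted, and it
  -- is nonzero at `p.snd`.
  have h2 := gainRank_le_isolate_of_ker hg (G := isolate G {u}) (v := p.snd) (x := x - y)
    (gainMatrix_isolate_mulVec_eq_zero (by rw [Matrix.mulVec_sub, hx, hy, sub_zero])
      (by simp [hxu, hyu])) (by
        rw [Pi.sub_apply, hxs, hys]
        have h1 : (g u p.snd : ℂ)⁻¹ ≠ 0 := inv_ne_zero (Circle.coe_ne_zero _)
        have h2 : Complex.I * (g u p.snd : ℂ)⁻¹ - -Complex.I * (g u p.snd : ℂ)⁻¹ =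
          2 * Complex.I * (g u p.snd : ℂ)⁻¹ := by ring
        rw [h2]
        simp [Complex.I_ne_zero])
  have h3 : gainRank g (isolate (isolate G {u}) {p.snd}) ≤
      gainRank g (isolate G {w | w ∈ p.support}) +
        ({w | w ∈ p.support} \ {u, p.snd} : Set V).ncard := by
    refine rank_le_of_forall_notMem_row_eq fun i hi j => ?_
    simp only [gainMatrix, Matrix.of_apply]
    congr 1
    simp only [isolate_adj, Set.mem_ofPred_eq, Set.mem_singleton_iff, eq_iff_iff]
    simp only [Set.mem_sdiff, Set.mem_ofPred_eq, Set.mem_insert_iff, Set.mem_singleton_iff, not_and,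
      not_not] at hi
    have hu := p.start_mem_support
    have hs := p.getVert_mem_support 1
    have hclosed : ∀ a b, G.Adj a b → a ∈ p.support → b ∈ p.support := fun a b hab ha =>
      p.snd_mem_support_of_mem_edges (h.2 a ha b hab)
    constructor
    · rintro ⟨⟨h1, h2, h3⟩, h4, h5⟩
      have : i ∉ p.support := fun hi' => (hi hi').elim h2 h4
      exact ⟨h1, this, fun hj => this (hclosed _ _ h1.symm hj)⟩
    · rintro ⟨h1, h2, h3⟩
      refine ⟨⟨h1, ?_, ?_⟩, ?_, ?_⟩ <;> rintro rfl <;> contradiction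
  have h4 : ({w | w ∈ p.support} \ {u, p.snd} : Set V).ncard + 2 = p.length := by
    rw [← ncard_support_of_isCycle h.1, ← Set.ncard_pair hadj.ne]
    refine Set.ncard_sdiff_add_ncard_of_subset ?_
    rintro w (rfl | rfl)
    · exact p.start_mem_support
    · exact p.getVert_mem_support 1
  lia

end CycleRank

/-! ### The lower bound for the rank and the structure of extremal graphs -/

section Extremal

variable {V : Type*} [Fintype V] {g : V → V → Circle}

omit [Fintype V] in
lemma eq_bot_of_forall_not_adj {G : SimpleGraph V} (h : ∀ a b, ¬ G.Adj a b) : G = ⊥ := by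
  ext a b
  simp [h]

lemma gainRank_bot (g : V → V → Circle) : gainRank g (⊥ : SimpleGraph V) = 0 := by
  have : gainMatrix g (⊥ : SimpleGraph V) = 0 := by
    ext i j
    simp [gainMatrix]
  rw [gainRank, this, Matrix.rank_zero]

theorem two_mul_matchingNumber_le_gainRank_add (g : V → V → Circle) (G : SimpleGraph V) :
    2 * (matchingNumber G : ℤ) ≤ gainRank g G + 2 * cyclomaticNumber G := by
  induction G using WellFoundedLT.induction with | _ G ih
  by_cases hE : ∃ a b, G.Adj a b
  · obtain ⟨a, b, hab⟩ := hE
    rcases exists_leaf_or_cycle hab with ⟨u, v, huv⟩ | ⟨v, hv⟩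
    · have h1 := ih _ (isolate_lt huv.1.symm (Set.mem_singleton v))
      have h2 := gainRank_isolate_leaf_add_two_le (g := g) huv
      have h3 := matchingNumber_le_isolate_add_one G v
      have h4 := cyclomaticNumber_mono (isolate_le G {v})
      lia
    · obtain ⟨w, hw⟩ := exists_isCycleEdge_of_mem_cycleVertices hv
      have h1 := ih _ (isolate_lt hw.mem_edgeSet (Set.mem_singleton v))
      have h2 := gainRank_isolate_le g G {v}
      have h3 := matchingNumber_le_isolate_add_one G v
      have h4 := cyclomaticNumber_isolate_of_mem_cycleVertices hv
      lia
  · push Not at hE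
    obtain rfl := eq_bot_of_forall_not_adj hE
    have : 2 * matchingNumber (⊥ : SimpleGraph V) ≤ (∅ : Set V).ncard :=
      two_mul_matchingNumber_le (by simp)
    rw [cyclomaticNumber_bot, gainRank_bot]
    simp at this
    simp [this]

/-- Equality in the lower bound of the rank by the matching and cyclomatic numbers. -/
def IsExtremal (g : V → V → Circle) (G : SimpleGraph V) : Prop :=
  2 * (matchingNumber G : ℤ) = gainRank g G + 2 * cyclomaticNumber G

/-- The bound also holds for the smaller graph, so equality for `G` leaves no slack in the inductive
step. -/
lemma IsExtremal.isolate_leaf {G : SimpleGraph V} (h : IsExtremal g G) {u v : V}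
    (huv : IsLeaf G u v) :
    IsExtremal g (isolate G {v}) ∧ cyclomaticNumber (isolate G {v}) = cyclomaticNumber G ∧
      gainRank g (isolate G {v}) + 2 = gainRank g G := by
  have h1 := two_mul_matchingNumber_le_gainRank_add g (isolate G {v})
  have h2 := gainRank_isolate_leaf_add_two_le (g := g) huv
  have h3 := matchingNumber_le_isolate_add_one G v
  have h4 := cyclomaticNumber_mono (isolate_le G {v})
  unfold IsExtremal at *
  lia

lemma IsExtremal.isolate_cycle {G : SimpleGraph V} (h : IsExtremal g G) {v : V}
    (hv : v ∈ cycleVertices G) :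
    IsExtremal g (isolate G {v}) ∧ cyclomaticNumber (isolate G {v}) + 1 = cyclomaticNumber G ∧
      gainRank g (isolate G {v}) = gainRank g G ∧
        matchingNumber (isolate G {v}) + 1 = matchingNumber G := by
  have h1 := two_mul_matchingNumber_le_gainRank_add g (isolate G {v})
  have h2 := gainRank_isolate_le g G {v}
  have h3 := matchingNumber_le_isolate_add_one G v
  have h4 := cyclomaticNumber_isolate_of_mem_cycleVertices hv
  unfold IsExtremal at *
  lia

lemma IsExtremal.cyclesSeparated {G : SimpleGraph V} (h : IsExtremal g G) : CyclesSeparated G :=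
  cyclesSeparated_of_cyclomaticNumber fun _ hv => (h.isolate_cycle hv).2.1.ge

/-- Every cycle is even and has the gain that makes it singular. -/
def GoodCycles (g : V → V → Circle) (G : SimpleGraph V) : Prop :=
  ∀ (u : V) (p : G.Walk u u), p.IsCycle →
    Even p.length ∧ (gainProd g p : ℂ) = (-1) ^ (p.length / 2)

omit [Fintype V] in
lemma GoodCycles.anti {G H : SimpleGraph V} (hGH : G ≤ H) (h : GoodCycles g H) :
    GoodCycles g G := by
  intro u p hp
  have := h u (p.transfer H (edges_subset_of_le hGH p)) (hp.transfer _)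
  rwa [gainProd_transfer, Walk.length_transfer] at this

omit [Fintype V] in
lemma GoodCycles.of_isolate {G : SimpleGraph V} {S : Set V} (h : GoodCycles g (isolate G S))
    {u : V} {p : G.Walk u u} (hp : p.IsCycle) (hS : ∀ w ∈ p.support, w ∉ S) :
    Even p.length ∧ (gainProd g p : ℂ) = (-1) ^ (p.length / 2) := by
  have := h u (p.transfer _ (edges_subset_isolate hS)) (hp.transfer _)
  rwa [gainProd_transfer, Walk.length_transfer] at this

/-- A set of vertices outside the cycles that covers all edges outside the cycles, together with a
matching outside the cycles of at least the same size; the rank is computed from it. -/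
def IsCertificate (g : V → V → Circle) (G : SimpleGraph V) (K : Set V) (M : Finset (Sym2 V)) :
    Prop :=
  (∀ v ∈ K, v ∉ cycleVertices G) ∧ IsMatchingSet G M ∧
    (∀ v ∈ coveredVertices M, v ∉ cycleVertices G) ∧ K.ncard ≤ M.card ∧
    (∀ a b, G.Adj a b → ¬ IsCycleEdge G s(a, b) → a ∈ K ∨ b ∈ K) ∧
    (gainRank g G : ℤ) = 2 * M.card + (cycleVertices G).ncard - 2 * cyclomaticNumber G

/-- In a graph without leaves, there is a terminal bridge beyond every bridge, and it leads to a
cycle. -/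
lemma exists_terminal_bridge_of_no_leaf {G : SimpleGraph V} (hleaf : ∀ u v, ¬ IsLeaf G u v)
    (a b : V) (hab : G.IsBridge s(a, b)) (hadj : G.Adj a b) :
    ∃ a' b', G.IsBridge s(a', b') ∧ G.Adj a' b' ∧ bridgeSide G a' b' ⊆ bridgeSide G a b ∧
      (∀ x ∈ bridgeSide G a' b', ∀ y, G.Adj x y → s(x, y) ≠ s(a', b') → IsCycleEdge G s(x, y)) ∧
        b' ∈ cycleVertices G := by
  obtain ⟨a', b', h1, h2, h3, h4⟩ := exists_terminal_bridge a b hab hadj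
  refine ⟨a', b', h1, h2, h3, h4, ?_⟩
  have : ∃ w, G.Adj b' w ∧ w ≠ a' := by
    by_contra hne
    push Not at hne
    exact hleaf b' a' ⟨h2.symm, hne⟩
  obtain ⟨w, hw, hwa⟩ := this
  refine (h4 b' (Reachable.refl _) w hw fun he => ?_).mem_cycleVertices (by simp)
  rcases Sym2.eq_iff.1 he with ⟨h, -⟩ | ⟨-, h⟩
  · exact h2.ne h.symm
  · exact hwa h

omit [Fintype V] in
lemma reachable_deleteEdges_of_isCycle {G : SimpleGraph V} {a b : V} (hab : G.IsBridge s(a, b))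
    {u x y : V} {p : G.Walk u u} (hp : p.IsCycle) (hx : x ∈ p.support) (hy : y ∈ p.support) :
    (G.deleteEdges {s(a, b)}).Reachable x y := by
  have : ∀ z ∈ p.support, (G.deleteEdges {s(a, b)}).Reachable u z := fun z hz =>
    reachable_deleteEdges_iff_exists_walk.2 ⟨p.takeUntil z hz, fun h =>
      hab.notMem_edges_of_isCycle hp (p.edges_takeUntil_subset_edges hz h)⟩
  exact (this x hx).symm.trans (this y hy)

/-- If there are no leaves and a single cycle, then there are no bridges. -/
lemma isCycleEdge_of_no_leaf {G : SimpleGraph V} (hleaf : ∀ u v, ¬ IsLeaf G u v) {u : V}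
    {p : G.Walk u u} (hp : p.IsCycle) (hone : ∀ x ∈ cycleVertices G, x ∈ p.support) {a b : V}
    (hadj : G.Adj a b) : IsCycleEdge G s(a, b) := by
  rw [isCycleEdge_iff hadj]
  intro hab
  obtain ⟨_, b₁, -, -, h1, -, h2⟩ := exists_terminal_bridge_of_no_leaf hleaf a b hab hadj
  have hba := hab
  rw [Sym2.eq_swap] at hba
  obtain ⟨_, b₂, -, -, h3, -, h4⟩ := exists_terminal_bridge_of_no_leaf hleaf b a hba hadj.symm
  have h5 : (G.deleteEdges {s(a, b)}).Reachable b b₁ := h1 (Reachable.refl _)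
  have h6 : (G.deleteEdges {s(b, a)}).Reachable a b₂ := h3 (Reachable.refl _)
  rw [Sym2.eq_swap] at h6
  exact isBridge_iff.1 hab
    (h6.trans ((reachable_deleteEdges_of_isCycle hab hp (hone _ h4) (hone _ h2)).trans h5.symm))

/-- Without leaves or further cycles every edge lies on `p`, so `p` is isolated. Tightness of the
rank at `u` supplies a kernel vector nonzero there, which determines the gain. -/
lemma IsExtremal.good_of_unique_cycle (hg : ∀ a b, g b a = (g a b)⁻¹) {G : SimpleGraph V}
    (h : IsExtremal g G) (hleaf : ∀ u v, ¬ IsLeaf G u v) {u : V}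
    {p : G.Walk u u} (hp : p.IsCycle) (hone : ∀ x ∈ cycleVertices G, x ∈ p.support) :
    Even p.length ∧ (gainProd g p : ℂ) = (-1) ^ (p.length / 2) := by
  have hall : ∀ a b, G.Adj a b → IsCycleEdge G s(a, b) := fun a b hab =>
    isCycleEdge_of_no_leaf hleaf hp hone hab
  have hu : u ∈ cycleVertices G := mem_cycleVertices_of_isCycle hp p.start_mem_support
  obtain ⟨-, -, hr, hm⟩ := h.isolate_cycle hu
  have hiso : IsIsolatedCycle p := by
    refine ⟨hp, fun w hw z hz => ?_⟩
    obtain ⟨x, q, hq, he⟩ := hall w z hz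
    exact h.cyclesSeparated _ _ w q p hq hp (q.fst_mem_support_of_mem_edges he) hw _ he
  have h2m : 2 * matchingNumber G ≤ p.length := by
    rw [← ncard_support_of_isCycle hp]
    exact two_mul_matchingNumber_le fun a b hab =>
      hone _ ((hall a b hab).mem_cycleVertices (by simp))
  -- An odd cycle minus `u` has a matching as large as any in `G`, contradicting that deleting `u`
  -- lowers the matching number.
  have heven : Even p.length := by
    by_contra hodd
    obtain ⟨N, hN, -, hNc⟩ := exists_isMatchingSet_of_odd_isCycle hp hodd
    have h1 := hN.ncard_coveredVertices
    have h2 : (coveredVertices N).ncard + 1 = p.length := by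
      rw [← ncard_support_of_isCycle hp, hNc]
      have := Set.ncard_sdiff_singleton_add_one (s := {w | w ∈ p.support}) p.start_mem_support
        (Set.toFinite _)
      rw [← this]
      rfl
    have h3 := (hN.isolate (S := {u}) (by rw [hNc]; exact fun w hw => hw.2)).card_le
    lia
  obtain ⟨x, hx, hxu⟩ := exists_ker_ne_zero hr
  exact ⟨heven, hiso.gainProd_eq_of_ker hg heven hx hxu⟩

/-- Here the cycle vertices are perfectly matched and carry all edges, so 2m = |O| and extremality
gives the rank. -/
lemma IsExtremal.isCertificate_of_no_bridge {G : SimpleGraph V}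
    (h : IsExtremal g G) (hgood : GoodCycles g G)
    (hall : ∀ a b, G.Adj a b → IsCycleEdge G s(a, b)) : IsCertificate g G ∅ ∅ := by
  obtain ⟨N, hN, hNc⟩ := exists_isMatchingSet_cycleVertices h.cyclesSeparated
    fun u p hp => (hgood u p hp).1
  have h1 := hN.ncard_coveredVertices
  have h2 := hN.card_le
  have h3 : 2 * matchingNumber G ≤ (cycleVertices G).ncard :=
    two_mul_matchingNumber_le fun a b hab => (hall a b hab).mem_cycleVertices (by simp)
  rw [hNc] at h1
  refine ⟨by simp, isMatchingSet_empty G, by simp [coveredVertices], by simp,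
    fun a b hab hne => absurd (hall a b hab) hne, ?_⟩
  unfold IsExtremal at h
  simp only [Finset.card_empty]
  lia

/-- A terminal bridge `s(a, b)` ends in a pendant cycle C through `b`, attached to the rest by that
bridge only. Deleting `b` gives (K₀, M₀), deleting its neighbour `p.snd` on C gives (K₁, M₁). Off C
the cover K₁ is charged to the part of M₀ there, on C to a matching of C minus both vertices; since
|M₀| = |M₁| ≥ |K₁|, the counts are tight. So `b` is not in K₁, which must cover the bridge by `a`,
and K₁ \ C with the part of M₀ off C is a certificate. -/
lemma IsExtremal.exists_isCertificate_of_bridge {G : SimpleGraph V}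
    (h : IsExtremal g G) (hgood : GoodCycles g G) (hleaf : ∀ u v, ¬ IsLeaf G u v)
    (hbridge : ∃ a b, G.Adj a b ∧ G.IsBridge s(a, b))
    (ih : ∀ v ∈ cycleVertices G, ∃ K M, IsCertificate g (isolate G {v}) K M) :
    ∃ K M, IsCertificate g G K M := by
  have hsep := h.cyclesSeparated
  obtain ⟨a₀, b₀, hadj₀, hbr₀⟩ := hbridge
  obtain ⟨a, b, hab, hadj, -, hterm, hb⟩ :=
    exists_terminal_bridge_of_no_leaf hleaf a₀ b₀ hbr₀ hadj₀
  obtain ⟨p, hp⟩ := exists_isCycle_of_mem_cycleVertices hb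
  have hlen := hp.three_le_length
  have hside : ∀ w ∈ p.support, w ∈ bridgeSide G a b := fun w hw =>
    reachable_deleteEdges_of_isCycle hab hp p.start_mem_support hw
  have hedge : ∀ w ∈ p.support, ∀ z, G.Adj w z → s(w, z) ≠ s(a, b) → s(w, z) ∈ p.edges := by
    intro w hw z hz hne
    obtain ⟨x, q, hq, he⟩ := hterm w (hside w hw) z hz hne
    exact hsep _ _ w q p hq hp (q.fst_mem_support_of_mem_edges he) hw _ he
  have ha : a ∉ p.support := fun hap => isBridge_iff.1 hab (Reachable.symm (hside a hap))
  have hs : p.snd ∈ p.support := p.getVert_mem_support 1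
  have hbs : G.Adj b p.snd := p.adj_snd hp.not_nil
  have hsO := mem_cycleVertices_of_isCycle hp hs
  obtain ⟨-, hc0, hr0, -⟩ := h.isolate_cycle hb
  obtain ⟨-, hc1, hr1, -⟩ := h.isolate_cycle hsO
  have hO0 := cycleVertices_isolate_of_isCycle hsep hp (S := {b})
    (by simp) (Set.singleton_nonempty _)
  have hO1 := cycleVertices_isolate_of_isCycle hsep hp (S := {p.snd})
    (Set.singleton_subset_iff.2 hs) (Set.singleton_nonempty _)
  obtain ⟨K₀, M₀, -, hM0, hM0O, -, -, hr0'⟩ := ih b hb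
  obtain ⟨K₁, M₁, hK1, -, -, hKM1, hcov1, hr1'⟩ := ih p.snd hsO
  rw [hO0] at hM0O hr0'
  rw [hO1] at hK1 hr1'
  have hC : (cycleVertices G \ {w | w ∈ p.support}).ncard + p.length =
      (cycleVertices G).ncard := by
    rw [← ncard_support_of_isCycle hp]
    exact Set.ncard_sdiff_add_ncard_of_subset fun w hw => mem_cycleVertices_of_isCycle hp hw
  set C : Set V := {w | w ∈ p.support} with hCdef
  have hcov1' : ∀ x y, G.Adj x y → x ≠ p.snd → y ≠ p.snd → ¬ IsCycleEdge G s(x, y) →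
      x ∈ K₁ ∨ y ∈ K₁ := fun x y hxy hx hy hne =>
    hcov1 x y ⟨hxy, hx, hy⟩ fun hc => hne (hc.mono (isolate_le _ _))
  let M := M₀.filter fun e => ∀ w ∈ e, w ∉ C
  let R := M₀.filter fun e => ¬ ∀ w ∈ e, w ∉ C
  have hMR : M.card + R.card = M₀.card := Finset.card_filter_add_card_filter_not _
  have hM : IsMatchingSet G M := (hM0.mono (isolate_le _ _)).subset (Finset.filter_subset _ _)
  have hR : IsMatchingSet G R := (hM0.mono (isolate_le _ _)).subset (Finset.filter_subset _ _)
  have hRC : coveredVertices R ⊆ C \ {b} := by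
    rintro w ⟨e, he, hwe⟩
    obtain ⟨heM, heC⟩ := Finset.mem_filter.1 he
    push Not at heC
    obtain ⟨x, hxe, hxC⟩ := heC
    refine ⟨?_, hM0.notMem_of_isolate ⟨e, heM, hwe⟩⟩
    obtain ⟨y, rfl⟩ := Sym2.mem_iff_exists.1 hxe
    have hxy := hM0.1 _ heM
    have hmem : s(x, y) ∈ p.edges := by
      refine hedge x hxC y hxy.1 fun heq => ?_
      rcases Sym2.eq_iff.1 heq with ⟨-, h⟩ | ⟨h, -⟩
      · exact hxy.2.2 h
      · exact hxy.2.1 h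
    exact p.mem_support_of_mem_edges hmem hwe
  -- `R` misses `b`, and the length is even, so in fact 2|R| + 2 ≤ `p.length`; hence |R| is at most
  -- the size of the matching `N` below.
  have hRcard : 2 * R.card + 1 ≤ p.length := by
    rw [← hR.ncard_coveredVertices, ← ncard_support_of_isCycle hp,
      ← Set.ncard_sdiff_singleton_add_one (s := {w | w ∈ p.support}) p.start_mem_support
        (Set.toFinite _)]
    exact Nat.add_le_add_right (Set.ncard_le_ncard hRC (Set.toFinite _)) 1
  have hMO : ∀ v ∈ coveredVertices M, v ∉ cycleVertices G := by
    rintro v ⟨e, he, hve⟩ hv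
    obtain ⟨heM, heC⟩ := Finset.mem_filter.1 he
    exact hM0O v ⟨e, heM, hve⟩ ⟨hv, heC v hve⟩
  have hMK : M.card ≤ (K₁ \ C).ncard := by
    refine (hM.card_le_ncard_of_cover (S := K₁ \ C) fun e he => ?_).trans
      (Set.ncard_le_ncard Set.inter_subset_left (Set.toFinite _))
    obtain ⟨heM, heC⟩ := Finset.mem_filter.1 he
    have hcv : ∀ w ∈ e, w ∈ coveredVertices M := fun w hw => ⟨e, he, hw⟩
    have heG := hM.1 e he
    induction e with | _ x y
    have hx := heC x (by simp)
    have hy := heC y (by simp)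
    rcases hcov1' x y heG (fun h => hx (h ▸ hs)) (fun h => hy (h ▸ hs))
      (fun hc => hMO x (hcv x (by simp)) (hc.mem_cycleVertices (by simp))) with h | h
    · exact ⟨x, ⟨h, hx⟩, by simp⟩
    · exact ⟨y, ⟨h, hy⟩, by simp⟩
  have hK1C : (K₁ \ C).ncard + (K₁ ∩ C).ncard = K₁.ncard :=
    (by rw [add_comm]; exact Set.ncard_inter_add_ncard_sdiff_eq_ncard _ _ (Set.toFinite _))
  obtain ⟨N, hN, hNe, hNc⟩ := exists_isMatchingSet_of_isCycle_diff hp (hgood b p hp).1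
  have hNcard : 2 * N.card + 2 = p.length := by
    rw [← hN.ncard_coveredVertices, hNc, ← ncard_support_of_isCycle hp,
      ← Set.ncard_pair hbs.ne]
    have := Set.ncard_sdiff_add_ncard_of_subset (s := {b, p.snd}) (t := {w | w ∈ p.support})
      (by rintro w (rfl | rfl); exacts [p.start_mem_support, hs]) (Set.toFinite _)
    rw [← this]
    congr 2
    ext w
    simp
  have hNK : N.card ≤ ((K₁ ∩ C) \ {b}).ncard := by
    refine (hN.card_le_ncard_of_cover (S := K₁) fun e he => ?_).trans
      (Set.ncard_le_ncard ?_ (Set.toFinite _))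
    · have hcv : ∀ w ∈ e, w ∈ coveredVertices N := fun w hw => ⟨e, he, hw⟩
      have heG := hN.1 e he
      induction e with | _ x y
      have hx := hcv x (by simp)
      have hy := hcv y (by simp)
      rw [hNc] at hx hy
      rcases hcov1 x y ⟨heG, hx.2.2, hy.2.2⟩ (fun hc => by
        have := hc.mem_cycleVertices (Sym2.mem_mk_left x y)
        rw [hO1] at this
        exact this.2 hx.1) with h | h
      · exact ⟨x, h, by simp⟩
      · exact ⟨y, h, by simp⟩
    · rw [hNc]
      exact fun w hw => ⟨⟨hw.1, hw.2.1⟩, hw.2.2.1⟩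
  -- Both deletions keep the rank, lower the cyclomatic number by one and leave the same cycle
  -- vertices, so the two rank formulas agree.
  have hM01 : M₀.card = M₁.card := by lia
  have hbK : b ∉ K₁ := by
    intro hbK
    have : ((K₁ ∩ C) \ {b}).ncard + 1 = (K₁ ∩ C).ncard :=
      Set.ncard_sdiff_singleton_add_one ⟨hbK, p.start_mem_support⟩ (Set.toFinite _)
    lia
  have hNK' : N.card ≤ (K₁ ∩ C).ncard :=
    hNK.trans (Set.ncard_le_ncard Set.sdiff_subset (Set.toFinite _))
  have hcovC : ∀ x y, x ∈ C → G.Adj x y → ¬ IsCycleEdge G s(x, y) → y ∈ K₁ \ C := by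
    intro x y hx hxy hne
    have heq : s(x, y) = s(a, b) := by
      by_contra hne'
      exact hne ⟨b, p, hp, hedge x hx y hxy hne'⟩
    rcases Sym2.eq_iff.1 heq with ⟨rfl, -⟩ | ⟨rfl, rfl⟩
    · exact absurd hx ha
    · rcases hcov1' x y hxy hbs.ne (fun h => ha (h ▸ hs)) hne with h | h
      · exact absurd h hbK
      · exact ⟨h, ha⟩
  refine ⟨K₁ \ C, M, ?_, hM, hMO, by lia, ?_, by lia⟩
  · rintro v ⟨hvK, hvC⟩ hvO
    exact hK1 v hvK ⟨hvO, hvC⟩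
  · intro x y hxy hne
    by_cases hx : x ∈ C
    · exact Or.inr (hcovC x y hx hxy hne)
    by_cases hy : y ∈ C
    · exact Or.inl (hcovC y x hy hxy.symm (by rwa [Sym2.eq_swap]))
    rcases hcov1' x y hxy (fun h => hx (h ▸ hs)) (fun h => hy (h ▸ hs)) hne with h | h
    · exact Or.inl ⟨h, hx⟩
    · exact Or.inr ⟨h, hy⟩

/-- By tightness deleting `v` does not lower the cyclomatic number, so `v` is on no cycle and may
join the cover, paid for by the edge to the leaf. -/
lemma IsCertificate.of_isolate_leaf {G : SimpleGraph V} (h : IsExtremal g G) {u v : V}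
    (huv : IsLeaf G u v) {K : Set V} {M : Finset (Sym2 V)}
    (hKM : IsCertificate g (isolate G {v}) K M) :
    IsCertificate g G (insert v K) ({s(u, v)} ∪ M) := by
  obtain ⟨-, hc, hr⟩ := h.isolate_leaf huv
  have hv : v ∉ cycleVertices G := fun hv => by
    have := cyclomaticNumber_isolate_of_mem_cycleVertices hv
    lia
  have hu : u ∉ cycleVertices G := fun hu => by
    obtain ⟨w, hw⟩ := exists_isCycleEdge_of_mem_cycleVertices hu
    obtain rfl := huv.2 w hw.mem_edgeSet
    exact hv (hw.mem_cycleVertices (by simp))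
  obtain ⟨h1, h2, h3, h4, h5, h6⟩ := hKM
  rw [cycleVertices_isolate_of_disjoint (by simpa using hv)] at h1 h3 h6
  have hcs : coveredVertices ({s(u, v)} : Finset (Sym2 V)) = {u, v} := by
    ext w
    simp [coveredVertices]
  have hd : Disjoint (coveredVertices {s(u, v)}) (coveredVertices M) := by
    rw [hcs, Set.disjoint_left]
    rintro w (rfl | rfl) ⟨e, he, hw⟩
    · obtain ⟨z, rfl⟩ := Sym2.mem_iff_exists.1 hw
      have := h2.1 _ he
      exact this.2.2 (huv.2 z this.1)
    · exact h2.notMem_of_isolate ⟨e, he, hw⟩ rfl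
  have hcard := card_union_of_disjoint_coveredVertices hd
  rw [Finset.card_singleton] at hcard
  refine ⟨?_, (isMatchingSet_singleton huv.1).union (h2.mono (isolate_le _ _)) hd, ?_, ?_, ?_, ?_⟩
  · rintro w (rfl | hw)
    exacts [hv, h1 w hw]
  · intro w hw
    rw [coveredVertices_union, hcs] at hw
    rcases hw with (rfl | rfl) | hw
    exacts [hu, hv, h3 w hw]
  · have := Set.ncard_insert_le v K
    lia
  · intro a b hab hne
    by_cases ha : a = v
    · exact Or.inl (Or.inl ha)
    by_cases hb : b = v
    · exact Or.inr (Or.inl hb)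
    exact (h5 a b ⟨hab, ha, hb⟩ fun hc => hne (hc.mono (isolate_le _ _))).imp Or.inr Or.inr
  · push_cast [hcard]
    lia

theorem IsExtremal.good_and_exists_isCertificate (hg : ∀ a b, g b a = (g a b)⁻¹)
    {G : SimpleGraph V} (h : IsExtremal g G) :
    GoodCycles g G ∧ ∃ K M, IsCertificate g G K M := by
  induction G using WellFoundedLT.induction with | _ G ih
  by_cases hleaf : ∃ u v, IsLeaf G u v
  · obtain ⟨u, v, huv⟩ := hleaf
    obtain ⟨he, hc, -⟩ := h.isolate_leaf huv
    obtain ⟨h1, K, M, h2⟩ := ih _ (isolate_lt huv.1.symm (Set.mem_singleton v)) he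
    refine ⟨fun x p hp => h1.of_isolate hp ?_, _, _, h2.of_isolate_leaf h huv⟩
    rintro w hw rfl
    have := cyclomaticNumber_isolate_of_mem_cycleVertices (mem_cycleVertices_of_isCycle hp hw)
    lia
  push Not at hleaf
  have hcyc : ∀ v ∈ cycleVertices G,
      GoodCycles g (isolate G {v}) ∧ ∃ K M, IsCertificate g (isolate G {v}) K M := by
    intro v hv
    obtain ⟨w, hw⟩ := exists_isCycleEdge_of_mem_cycleVertices hv
    exact ih _ (isolate_lt hw.mem_edgeSet (Set.mem_singleton v)) (h.isolate_cycle hv).1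
  have hgood : GoodCycles g G := by
    intro u p hp
    by_cases hone : ∀ x ∈ cycleVertices G, x ∈ p.support
    · exact h.good_of_unique_cycle hg hleaf hp hone
    · push Not at hone
      obtain ⟨x, hx, hxp⟩ := hone
      exact (hcyc x hx).1.of_isolate hp (by rintro w hw rfl; exact hxp hw)
  refine ⟨hgood, ?_⟩
  by_cases hall : ∀ a b, G.Adj a b → IsCycleEdge G s(a, b)
  · exact ⟨∅, ∅, h.isCertificate_of_no_bridge hgood hall⟩
  · push Not at hall
    obtain ⟨a, b, hab, hne⟩ := hall
    rw [isCycleEdge_iff hab, not_not] at hne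
    exact h.exists_isCertificate_of_bridge hgood hleaf ⟨a, b, hab, hne⟩ fun v hv => (hcyc v hv).2

end Extremal

/-! ### The contracted graph: Kőnig duality and the converse -/

section Contraction

/-- Kőnig's theorem for forests. -/
lemma exists_cover_and_matching_of_forall_isBridge {W : Type*} [Finite W] (T : SimpleGraph W)
    (hT : ∀ a b, T.Adj a b → T.IsBridge s(a, b)) :
    ∃ (K : Set W) (M : Finset (Sym2 W)), IsMatchingSet T M ∧
      (∀ a b, T.Adj a b → a ∈ K ∨ b ∈ K) ∧ K.ncard ≤ M.card := by
  induction T using WellFoundedLT.induction with | _ T ih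
  by_cases hE : ∃ a b, T.Adj a b
  · obtain ⟨a, b, hab⟩ := hE
    rcases exists_leaf_or_cycle hab with ⟨u, v, huv⟩ | ⟨v, hv⟩
    · obtain ⟨K, M, h1, h2, h3⟩ := ih _ (isolate_lt huv.1.symm (Set.mem_singleton v))
        fun a b hab => (hT a b hab.1).anti (isolate_le _ _)
      have hcs : coveredVertices ({s(u, v)} : Finset (Sym2 W)) = {u, v} := by
        ext w
        simp [coveredVertices]
      have hd : Disjoint (coveredVertices {s(u, v)}) (coveredVertices M) := by
        rw [hcs, Set.disjoint_left]
        rintro w (rfl | rfl) ⟨e, he, hw⟩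
        · obtain ⟨z, rfl⟩ := Sym2.mem_iff_exists.1 hw
          have := h1.1 _ he
          exact this.2.2 (huv.2 z this.1)
        · exact h1.notMem_of_isolate ⟨e, he, hw⟩ rfl
      have hcard := card_union_of_disjoint_coveredVertices hd
      rw [Finset.card_singleton] at hcard
      refine ⟨insert v K, {s(u, v)} ∪ M,
        (isMatchingSet_singleton huv.1).union (h1.mono (isolate_le _ _)) hd, ?_, ?_⟩
      · intro a b hab
        by_cases ha : a = v
        · exact Or.inl (Or.inl ha)
        by_cases hb : b = v
        · exact Or.inr (Or.inl hb)
        exact (h2 a b ⟨hab, ha, hb⟩).imp Or.inr Or.inr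
      · have := Set.ncard_insert_le v K
        lia
    · obtain ⟨w, hw⟩ := exists_isCycleEdge_of_mem_cycleVertices hv
      exact absurd (hT _ _ hw.mem_edgeSet) ((isCycleEdge_iff hw.mem_edgeSet).1 hw)
  · push Not at hE
    exact ⟨∅, ∅, isMatchingSet_empty T, fun a b hab => absurd hab (hE a b), by simp⟩

lemma IsMatchingSet.card_le_of_map {V W : Type*} [Finite W] {G : SimpleGraph V}
    {H : SimpleGraph W} {M : Finset (Sym2 V)} (hM : IsMatchingSet G M) (f : V → W)
    (hf : Set.InjOn f (coveredVertices M)) (hadj : ∀ e ∈ M, e.map f ∈ H.edgeSet) :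
    M.card ≤ matchingNumber H := by
  have hmem : ∀ e ∈ M, ∀ f' ∈ M, ∀ w, w ∈ e.map f → w ∈ f'.map f → e = f' := by
    intro e he e' he' w hw hw'
    obtain ⟨a, ha, rfl⟩ := Sym2.mem_map.1 hw
    obtain ⟨b, hb, hab⟩ := Sym2.mem_map.1 hw'
    obtain rfl := hf ⟨e', he', hb⟩ ⟨e, he, ha⟩ hab
    exact hM.2 e he e' he' b ha hb
  have hinj : Set.InjOn (Sym2.map f) (M : Set (Sym2 V)) := by
    intro e he e' he' h
    obtain ⟨a, ha⟩ : ∃ a, a ∈ e := by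
      induction e with | _ a b
      exact ⟨a, by simp⟩
    have : f a ∈ e.map f := Sym2.mem_map.2 ⟨a, ha, rfl⟩
    exact hmem e he e' he' (f a) this (h ▸ this)
  rw [← Finset.card_image_of_injOn hinj]
  refine IsMatchingSet.card_le (G := H) ⟨?_, ?_⟩
  · intro e he
    obtain ⟨e', he', rfl⟩ := Finset.mem_image.1 he
    exact hadj e' he'
  · intro e he e' he' w hw hw'
    obtain ⟨d, hd, rfl⟩ := Finset.mem_image.1 he
    obtain ⟨d', hd', rfl⟩ := Finset.mem_image.1 he'
    rw [hmem d hd d' hd' w hw hw']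

variable {V : Type*}

/-- The class of a vertex in the graph with contracted cycles. -/
def cycleClass (G : SimpleGraph V) (v : V) : Quotient (cycleSetoid G) := Quotient.mk _ v

lemma cycleClass_eq_iff {G : SimpleGraph V} {a b : V} : cycleClass G a = cycleClass G b ↔
    Relation.EqvGen (fun u v => ∃ C ∈ cycles G, u ∈ C.verts ∧ v ∈ C.verts) a b :=
  Quotient.eq (r := cycleSetoid G)

lemma contractCycles_adj {G : SimpleGraph V} {q r : Quotient (cycleSetoid G)} :
    (contractCycles G).Adj q r ↔
      q ≠ r ∧ ∃ a b, G.Adj a b ∧ cycleClass G a = q ∧ cycleClass G b = r := Iff.rfl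

lemma eq_of_cycleClass_eq {G : SimpleGraph V} {a b : V} (h : cycleClass G a = cycleClass G b) :
    a = b ∨ (a ∈ cycleVertices G ∧ b ∈ cycleVertices G) := by
  rw [cycleClass_eq_iff] at h
  induction h with
  | rel a b h =>
    obtain ⟨C, hC, ha, hb⟩ := h
    exact Or.inr ⟨⟨C, hC, ha⟩, ⟨C, hC, hb⟩⟩
  | refl a => exact Or.inl rfl
  | symm a b _ ih => exact ih.imp Eq.symm And.symm
  | trans a b c _ _ ih1 ih2 =>
    rcases ih1 with rfl | h1
    · exact ih2
    · rcases ih2 with rfl | h2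
      · exact Or.inr h1
      · exact Or.inr ⟨h1.1, h2.2⟩

/-- No cycle crosses a bridge, so every contracted class stays connected when a bridge is removed.
-/
lemma reachable_of_cycleClass_eq {G : SimpleGraph V} {x y : V} (hxy : G.IsBridge s(x, y))
    {a b : V} (h : cycleClass G a = cycleClass G b) :
    (G.deleteEdges {s(x, y)}).Reachable a b := by
  rw [cycleClass_eq_iff] at h
  induction h with
  | rel a b h =>
    obtain ⟨_, ⟨u, p, hp, rfl⟩, ha, hb⟩ := h
    exact reachable_deleteEdges_of_isCycle hxy hp (by simpa using ha) (by simpa using hb)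
  | refl a => exact Reachable.refl _
  | symm a b _ ih => exact ih.symm
  | trans a b c _ _ ih1 ih2 => exact ih1.trans ih2

lemma cycleClass_ne_of_isBridge {G : SimpleGraph V} {x y : V} (hxy : G.IsBridge s(x, y)) :
    cycleClass G x ≠ cycleClass G y :=
  fun h => isBridge_iff.1 hxy (reachable_of_cycleClass_eq hxy h)

lemma contractCycles_adj_of_isBridge {G : SimpleGraph V} {x y : V} (hadj : G.Adj x y)
    (hxy : G.IsBridge s(x, y)) :
    (contractCycles G).Adj (cycleClass G x) (cycleClass G y) :=
  contractCycles_adj.2 ⟨cycleClass_ne_of_isBridge hxy, x, y, hadj, rfl, rfl⟩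

lemma isBridge_of_cycleClass_ne {G : SimpleGraph V} {x y : V} (hadj : G.Adj x y)
    (h : cycleClass G x ≠ cycleClass G y) : G.IsBridge s(x, y) := by
  by_contra hb
  rw [← isCycleEdge_iff hadj] at hb
  obtain ⟨u, p, hp, he⟩ := hb
  exact h (cycleClass_eq_iff.2 (Relation.EqvGen.rel _ _ ⟨p.toSubgraph, ⟨u, p, hp, rfl⟩,
    by simpa using p.fst_mem_support_of_mem_edges he,
    by simpa using p.snd_mem_support_of_mem_edges he⟩))

/-- Contracting the cycles gives a forest. -/
lemma contractCycles_isBridge (G : SimpleGraph V) (q r : Quotient (cycleSetoid G))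
    (h : (contractCycles G).Adj q r) : (contractCycles G).IsBridge s(q, r) := by
  obtain ⟨hne, x, y, hadj, rfl, rfl⟩ := contractCycles_adj.1 h
  have hxy := isBridge_of_cycleClass_ne hadj hne
  -- Walks lift: an edge of the contraction comes from an edge of `G`, and passing between
  -- representatives of one class avoids the bridge.
  have key : ∀ (q r : Quotient (cycleSetoid G)), ((contractCycles G).deleteEdges
      {s(cycleClass G x, cycleClass G y)}).Reachable q r → ∀ a b, cycleClass G a = q →
        cycleClass G b = r → (G.deleteEdges {s(x, y)}).Reachable a b := by
    rintro q r ⟨w⟩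
    induction w with
    | nil =>
      intro a b ha hb
      exact reachable_of_cycleClass_eq hxy (ha.trans hb.symm)
    | cons hw w ih =>
      intro a b ha hb
      rw [deleteEdges_adj] at hw
      obtain ⟨hw1, hw2⟩ := hw
      obtain ⟨-, c, d, hcd, rfl, rfl⟩ := contractCycles_adj.1 hw1
      refine (reachable_of_cycleClass_eq hxy ha).trans (Reachable.trans (Adj.reachable ?_)
        (ih d b rfl hb))
      rw [deleteEdges_adj]
      refine ⟨hcd, fun he => hw2 ?_⟩
      have := congrArg (Sym2.map (cycleClass G)) (Set.mem_singleton_iff.1 he)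
      simpa using this
  rw [isBridge_iff]
  exact fun h => isBridge_iff.1 hxy (key _ _ h x y rfl rfl)

variable [Fintype V]

lemma IsMatchingSet.card_le_deleteVertices {G : SimpleGraph V} {S : Set V} {M : Finset (Sym2 V)}
    (hM : IsMatchingSet G M) (hS : ∀ v ∈ coveredVertices M, v ∉ S) :
    M.card ≤ matchingNumber (deleteVertices G S) := by
  let N : Finset (Sym2 ↥Sᶜ) := Finset.univ.filter fun e => e.map Subtype.val ∈ M
  have hN : IsMatchingSet (deleteVertices G S) N := by
    constructor
    · intro e he
      have := hM.1 _ (Finset.mem_filter.1 he).2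
      induction e with | _ a b
      exact this
    · intro e he f hf w hwe hwf
      exact Sym2.map.injective Subtype.val_injective (hM.2 _ (Finset.mem_filter.1 he).2 _
        (Finset.mem_filter.1 hf).2 w.1 (Sym2.mem_map.2 ⟨w, hwe, rfl⟩)
        (Sym2.mem_map.2 ⟨w, hwf, rfl⟩))
  have himage : M ⊆ N.image (Sym2.map Subtype.val) := by
    intro e he
    have hcv : ∀ w ∈ e, w ∈ Sᶜ := fun w hw => hS w ⟨e, he, hw⟩
    induction e with | _ a b
    refine Finset.mem_image.2 ⟨s(⟨a, hcv a (by simp)⟩, ⟨b, hcv b (by simp)⟩), ?_, rfl⟩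
    exact Finset.mem_filter.2 ⟨Finset.mem_univ _, he⟩
  exact (Finset.card_le_card himage).trans (Finset.card_image_le.trans hN.card_le)

lemma exists_isMatchingSet_deleteVertices (G : SimpleGraph V) (S : Set V) :
    ∃ M, IsMatchingSet G M ∧ (∀ v ∈ coveredVertices M, v ∉ S) ∧
      M.card = matchingNumber (deleteVertices G S) := by
  obtain ⟨N, hN, hcard⟩ := exists_isMatchingSet_card_eq (deleteVertices G S)
  refine ⟨N.image (Sym2.map Subtype.val), ⟨?_, ?_⟩, ?_, ?_⟩
  · intro e he
    obtain ⟨d, hd, rfl⟩ := Finset.mem_image.1 he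
    have := hN.1 d hd
    induction d with | _ a b
    exact this
  · intro e he f hf w hwe hwf
    obtain ⟨d, hd, rfl⟩ := Finset.mem_image.1 he
    obtain ⟨d', hd', rfl⟩ := Finset.mem_image.1 hf
    obtain ⟨a, ha, rfl⟩ := Sym2.mem_map.1 hwe
    obtain ⟨b, hb, hab⟩ := Sym2.mem_map.1 hwf
    obtain rfl := Subtype.val_injective hab
    rw [hN.2 d hd d' hd' b ha hb]
  · rintro v ⟨e, he, hve⟩
    obtain ⟨d, hd, rfl⟩ := Finset.mem_image.1 he
    obtain ⟨a, ha, rfl⟩ := Sym2.mem_map.1 hve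
    exact a.2
  · rw [Finset.card_image_of_injective _ (Sym2.map.injective Subtype.val_injective), hcard]

lemma IsMatchingSet.card_le_contractCycles {G : SimpleGraph V} {M : Finset (Sym2 V)}
    (hM : IsMatchingSet G M) (hS : ∀ v ∈ coveredVertices M, v ∉ cycleVertices G) :
    M.card ≤ matchingNumber (contractCycles G) := by
  refine hM.card_le_of_map (cycleClass G) (fun a ha b _ hab => ?_) fun e he => ?_
  · exact (eq_of_cycleClass_eq hab).resolve_right fun h => hS a ha h.1
  · have hadj := hM.1 e he
    have hcv : ∀ w ∈ e, w ∉ cycleVertices G := fun w hw => hS w ⟨e, he, hw⟩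
    induction e with | _ a b
    refine contractCycles_adj_of_isBridge hadj ?_
    by_contra hb
    rw [← isCycleEdge_iff hadj] at hb
    exact hcv a (by simp) (hb.mem_cycleVertices (by simp))

lemma matchingNumber_deleteVertices_le_contractCycles (G : SimpleGraph V) :
    matchingNumber (deleteVertices G (cycleVertices G)) ≤ matchingNumber (contractCycles G) := by
  obtain ⟨M, hM, hMO, hcard⟩ := exists_isMatchingSet_deleteVertices G (cycleVertices G)
  exact hcard ▸ hM.card_le_contractCycles hMO

/-- Every edge of the contraction comes from a bridge, so the classes of `K` form a vertex cover
there. -/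
lemma matchingNumber_contractCycles_le {G : SimpleGraph V} {K : Set V}
    (hK : ∀ a b, G.Adj a b → ¬ IsCycleEdge G s(a, b) → a ∈ K ∨ b ∈ K) :
    matchingNumber (contractCycles G) ≤ K.ncard := by
  obtain ⟨N, hN, hcard⟩ := exists_isMatchingSet_card_eq (contractCycles G)
  rw [← hcard]
  refine (hN.card_le_ncard_of_cover (S := cycleClass G '' K) fun e he => ?_).trans
    ((Set.ncard_le_ncard Set.inter_subset_left (Set.toFinite _)).trans
      (Set.ncard_image_le (Set.toFinite _)))
  have h := hN.1 e he
  induction e with | _ q r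
  obtain ⟨hne, a, b, hab, rfl, rfl⟩ := contractCycles_adj.1 h
  have hb := isBridge_of_cycleClass_ne hab hne
  rcases hK a b hab (fun hc => (isCycleEdge_iff hab).1 hc hb) with h | h
  · exact ⟨_, ⟨a, h, rfl⟩, by simp⟩
  · exact ⟨_, ⟨b, h, rfl⟩, by simp⟩

lemma IsCertificate.matchingNumber_eq {g : V → V → Circle} {G : SimpleGraph V} {K : Set V}
    {M : Finset (Sym2 V)} (h : IsCertificate g G K M) :
    matchingNumber (contractCycles G) =
      matchingNumber (deleteVertices G (cycleVertices G)) := by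
  obtain ⟨-, hM, hMO, hKM, hcov, -⟩ := h
  exact le_antisymm ((matchingNumber_contractCycles_le hcov).trans
    (hKM.trans (hM.card_le_deleteVertices hMO))) (matchingNumber_deleteVertices_le_contractCycles G)

omit [Fintype V] in
lemma isCycleEdge_isolate {G : SimpleGraph V} {S : Set V} {e : Sym2 V} {u : V} {p : G.Walk u u}
    (hp : p.IsCycle) (he : e ∈ p.edges) (hS : ∀ w ∈ p.support, w ∉ S) :
    IsCycleEdge (isolate G S) e :=
  ⟨u, p.transfer _ (edges_subset_isolate hS), hp.transfer _, by simpa using he⟩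

/-- The rank of a disjoint union of singular even cycles. -/
lemma gainRank_add_two_mul_cyclomaticNumber_le {g : V → V → Circle}
    (hg : ∀ a b, g b a = (g a b)⁻¹) {G : SimpleGraph V} (hsep : CyclesSeparated G)
    (hgood : GoodCycles g G) (hall : ∀ a b, G.Adj a b → IsCycleEdge G s(a, b)) :
    (gainRank g G : ℤ) + 2 * cyclomaticNumber G ≤ (cycleVertices G).ncard := by
  induction G using WellFoundedLT.induction with | _ G ih
  by_cases hE : ∃ a b, G.Adj a b
  · obtain ⟨a, b, hab⟩ := hE
    obtain ⟨u, p, hp, he⟩ := hall a b hab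
    have hap := p.fst_mem_support_of_mem_edges he
    have hiso : IsIsolatedCycle p := by
      refine ⟨hp, fun w hw z hz => ?_⟩
      obtain ⟨x, q, hq, he⟩ := hall w z hz
      exact hsep _ _ w q p hq hp (q.fst_mem_support_of_mem_edges he) hw _ he
    set H := isolate G {w | w ∈ p.support} with hH
    have hle : H ≤ G := isolate_le _ _
    have h1 := hiso.gainRank_le hg (hgood u p hp).1 (hgood u p hp).2
    -- After one edge of `p` is removed, its other edges are bridges: a cycle through one of them
    -- would meet `p` and hence, by separation, use the removed edge.
    have h2 : cyclomaticNumber G ≤ cyclomaticNumber H + 1 := by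
      refine (le_cyclomaticNumber_deleteEdges (e := s(a, b)) hab).trans
        (Int.add_le_add_right (cyclomaticNumber_le_of_forall_isBridge ?_ ?_) 1)
      · intro x y hxy
        rw [deleteEdges_adj]
        refine ⟨hxy.1, fun h => ?_⟩
        rcases Sym2.eq_iff.1 (Set.mem_singleton_iff.1 h) with ⟨rfl, -⟩ | ⟨-, rfl⟩
        · exact hxy.2.1 hap
        · exact hxy.2.2 hap
      · intro f hf hfH
        by_contra hb
        rw [← isCycleEdge_iff hf] at hb
        obtain ⟨w, q, hq, hfq⟩ := hb
        have hqle := edges_subset_of_le (deleteEdges_le (G := G) {s(a, b)}) q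
        have hfG := edgeSet_mono (deleteEdges_le (G := G) {s(a, b)}) hf
        have : ∃ z ∈ f, z ∈ p.support := by
          by_contra hne
          push Not at hne
          apply hfH
          induction f with | _ x y
          exact ⟨hfG, hne x (by simp), hne y (by simp)⟩
        obtain ⟨z, hzf, hzp⟩ := this
        have := hsep _ _ z p (q.transfer G hqle) hp (hq.transfer _) hzp
          (by simpa using q.mem_support_of_mem_edges hfq hzf) _ he
        rw [Walk.edges_transfer] at this
        have := q.edges_subset_edgeSet this
        rw [edgeSet_deleteEdges] at this
        exact this.2 rfl
    have h3 := ih H (isolate_lt hab hap) (hsep.anti hle) (hgood.anti hle) (by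
      intro x y hxy
      obtain ⟨w, q, hq, hq'⟩ := hall x y hxy.1
      refine isCycleEdge_isolate hq hq' fun z hz hzp => hxy.2.1 ?_
      exact hsep.mem_support hq hp hz hzp (q.fst_mem_support_of_mem_edges hq'))
    rw [hH, cycleVertices_isolate_of_isCycle hsep hp subset_rfl ⟨a, hap⟩] at h3
    have h4 : (cycleVertices G \ {w | w ∈ p.support}).ncard + p.length =
        (cycleVertices G).ncard := by
      rw [← ncard_support_of_isCycle hp]
      exact Set.ncard_sdiff_add_ncard_of_subset fun w hw => mem_cycleVertices_of_isCycle hp hw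
    lia
  · push Not at hE
    obtain rfl := eq_bot_of_forall_not_adj hE
    rw [cyclomaticNumber_bot, gainRank_bot]
    simp

lemma isExtremal_of_matchingNumber_eq {g : V → V → Circle} (hg : ∀ a b, g b a = (g a b)⁻¹)
    {G : SimpleGraph V} (hsep : CyclesSeparated G) (hgood : GoodCycles g G)
    (hm : matchingNumber (contractCycles G) =
      matchingNumber (deleteVertices G (cycleVertices G))) : IsExtremal g G := by
  obtain ⟨K', M', hM', hcov', hcard'⟩ :=
    exists_cover_and_matching_of_forall_isBridge _ (contractCycles_isBridge G)
  obtain ⟨M, hM, hMO, hMcard⟩ := exists_isMatchingSet_deleteVertices G (cycleVertices G)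
  obtain ⟨N, hN, hNc⟩ := exists_isMatchingSet_cycleVertices hsep fun u p hp => (hgood u p hp).1
  have hK'M : K'.ncard ≤ M.card := hcard'.trans (hM'.card_le.trans (by rw [hm, hMcard]))
  -- Off the cycles, classes are singletons, so this is the part of `K'` away from the contracted
  -- cycles.
  let K : Set V := {v | v ∉ cycleVertices G ∧ cycleClass G v ∈ K'}
  have hbr : ∀ a b, G.Adj a b → (a ∉ cycleVertices G ∨ b ∉ cycleVertices G) →
      G.IsBridge s(a, b) := by
    intro a b hab h
    by_contra hb
    rw [← isCycleEdge_iff hab] at hb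
    rcases h with h | h <;> exact h (hb.mem_cycleVertices (by simp))
  have hMK : M.card ≤ K.ncard := by
    refine (hM.card_le_ncard_of_cover (S := K) fun e he => ?_).trans
      (Set.ncard_le_ncard Set.inter_subset_left (Set.toFinite _))
    have hadj := hM.1 e he
    have hcv : ∀ w ∈ e, w ∉ cycleVertices G := fun w hw => hMO w ⟨e, he, hw⟩
    induction e with | _ a b
    have ha := hcv a (by simp)
    have hb := hcv b (by simp)
    rcases hcov' _ _ (contractCycles_adj_of_isBridge hadj (hbr a b hadj (Or.inl ha))) with h | h
    · exact ⟨a, ⟨ha, h⟩, by simp⟩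
    · exact ⟨b, ⟨hb, h⟩, by simp⟩
  have hKK' : K.ncard ≤ (K' \ cycleClass G '' cycleVertices G).ncard := by
    refine Set.ncard_le_ncard_of_injOn (cycleClass G) ?_ ?_ (Set.toFinite _)
    · rintro v ⟨hv, hvK⟩
      refine ⟨hvK, ?_⟩
      rintro ⟨w, hw, hwv⟩
      rcases eq_of_cycleClass_eq hwv with rfl | h
      · exact hv hw
      · exact hv h.2
    · intro a ha b _ hab
      exact (eq_of_cycleClass_eq hab).resolve_right fun h => ha.1 h.1
  -- A contracted cycle in `K'` would give |K| < |K'| ≤ |M| ≤ |K|.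
  have hK'O : ∀ v ∈ cycleVertices G, cycleClass G v ∉ K' := by
    intro v hv hvK
    have : (K' \ cycleClass G '' cycleVertices G).ncard < K'.ncard :=
      Set.ncard_lt_ncard ⟨Set.sdiff_subset, fun h => (h hvK).2 ⟨v, hv, rfl⟩⟩ (Set.toFinite _)
    lia
  have hKleK' : K.ncard ≤ K'.ncard :=
    hKK'.trans (Set.ncard_le_ncard Set.sdiff_subset (Set.toFinite _))
  have hcov : ∀ a b, G.Adj a b → G.IsBridge s(a, b) → a ∈ K ∨ b ∈ K := by
    intro a b hab hb
    rcases hcov' _ _ (contractCycles_adj_of_isBridge hab hb) with h | h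
    · exact Or.inl ⟨fun ha => hK'O a ha h, h⟩
    · exact Or.inr ⟨fun hb => hK'O b hb h, h⟩
  have hKO : ∀ v ∈ K, v ∉ cycleVertices G := fun v hv => hv.1
  have hle := isolate_le G K
  have h1 := gainRank_le_isolate_add g G K
  have h2 := gainRank_add_two_mul_cyclomaticNumber_le hg (hsep.anti hle) (hgood.anti hle) (by
    intro a b hab
    have hc : IsCycleEdge G s(a, b) := by
      rw [isCycleEdge_iff hab.1]
      exact fun hb => (hcov a b hab.1 hb).elim hab.2.1 hab.2.2
    obtain ⟨u, p, hp, he⟩ := hc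
    exact isCycleEdge_isolate hp he fun w hw hwK =>
      hKO w hwK (mem_cycleVertices_of_isCycle hp hw))
  rw [cycleVertices_isolate_of_disjoint hKO] at h2
  have h3 : cyclomaticNumber G ≤ cyclomaticNumber (isolate G K) := by
    refine cyclomaticNumber_le_of_forall_isBridge hle fun e he hne => ?_
    induction e with | _ a b
    by_cases ha : a ∈ K
    · exact hbr a b he (Or.inl (hKO a ha))
    by_cases hb : b ∈ K
    · exact hbr a b he (Or.inr (hKO b hb))
    · exact absurd ⟨he, ha, hb⟩ hne
  have hd : Disjoint (coveredVertices M) (coveredVertices N) := by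
    rw [hNc, Set.disjoint_left]
    exact hMO
  have h4 := (hM.union hN hd).card_le
  rw [card_union_of_disjoint_coveredVertices hd] at h4
  have h5 := hN.ncard_coveredVertices
  rw [hNc] at h5
  have h6 := two_mul_matchingNumber_le_gainRank_add g G
  unfold IsExtremal
  lia

end Contraction

/-! ### Transfer to gain graphs and conclusion -/

/-- The gains of a gain graph, extended by one to pairs of non-adjacent vertices. -/
noncomputable def UnitGainGraph.totalGain {V : Type*} (Φ : UnitGainGraph V) (a b : V) : Circle :=
  if h : Φ.graph.Adj a b then Φ.gain ⟨(a, b), h⟩ else 1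

/-- The default value one is its own inverse, so the relation extends to all pairs. -/
lemma UnitGainGraph.totalGain_symm {V : Type*} (Φ : UnitGainGraph V) (a b : V) :
    Φ.totalGain b a = (Φ.totalGain a b)⁻¹ := by
  unfold totalGain
  by_cases h : Φ.graph.Adj a b
  · rw [dif_pos h, dif_pos h.symm]
    exact Φ.gain_symm ⟨(a, b), h⟩
  · rw [dif_neg h, dif_neg fun h' => h h'.symm, inv_one]

lemma UnitGainGraph.rank_eq_gainRank {V : Type*} [Fintype V] (Φ : UnitGainGraph V) :
    Φ.rank = gainRank Φ.totalGain Φ.graph := by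
  unfold UnitGainGraph.rank gainRank
  congr 1
  ext i j
  by_cases h : Φ.graph.Adj i j <;> simp [UnitGainGraph.adjMatrix, gainMatrix, totalGain, h]

lemma UnitGainGraph.walkGain_eq_gainProd {V : Type*} (Φ : UnitGainGraph V) {u v : V}
    (p : Φ.graph.Walk u v) : Φ.walkGain p = gainProd Φ.totalGain p := by
  unfold walkGain gainProd
  congr 2
  ext d
  simp [totalGain, d.adj]

end UnitGain

theorem theorem1p11 {V : Type*} [Fintype V] (Φ : UnitGainGraph V) (hΦ : Φ.graph.Connected) :
    (Φ.rank : ℤ) = 2 * (matchingNumber Φ.graph : ℤ) - 2 * cyclomaticNumber Φ.graph ↔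
      CyclesDisjoint Φ.graph ∧
      (∀ (v : V) (C : Φ.graph.Walk v v), C.IsCycle →
        Even C.length ∧ (Φ.walkGain C : ℂ) = (-1) ^ (C.length / 2)) ∧
      matchingNumber (contractCycles Φ.graph) =
        matchingNumber (deleteVertices Φ.graph (cycleVertices Φ.graph)) := by
  have hgood : (∀ (v : V) (C : Φ.graph.Walk v v), C.IsCycle →
      Even C.length ∧ (Φ.walkGain C : ℂ) = (-1) ^ (C.length / 2)) ↔
        GoodCycles Φ.totalGain Φ.graph := by
    simp only [GoodCycles, Φ.walkGain_eq_gainProd]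
  have hext : (Φ.rank : ℤ) = 2 * (matchingNumber Φ.graph : ℤ) - 2 * cyclomaticNumber Φ.graph ↔
      IsExtremal Φ.totalGain Φ.graph := by
    rw [Φ.rank_eq_gainRank, IsExtremal]
    lia
  rw [hgood, hext, ← cyclesSeparated_iff]
  constructor
  · intro h
    obtain ⟨h1, K, M, h2⟩ := h.good_and_exists_isCertificate Φ.totalGain_symm
    exact ⟨h.cyclesSeparated, h1, h2.matchingNumber_eq⟩
  · rintro ⟨h1, h2, h3⟩
    exact isExtremal_of_matchingNumber_eq Φ.totalGain_symm h1 h2 h3
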